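/- \textbf{Theorem.} Let $n\ge 1$, $0<\alpha<n$ and $1<p<q<\infty$, and write $p'=p/(p-1)$, $q'=q/(q-1)$. A weight is a nonnegative, locally integrable function on $\mathbb R^n$; for a weight $w$ put $w(E)=\int_E w\,dx$. Cubes are half-open with sides parallel to the axes, $\ell(Q)$ is the side length of $Q$, and $\langle f\rangle_Q=|Q|^{-1}\int_Q f\,dx$ is the average of $f$ over $Q$. For a cube $Q$, $1\le r<\infty$ and an increasing function $\Phi:[0,\infty)\to[0,\infty)$, put $$\|f\|_{r,Q}=\big\langle |f|^r\big\rangle_Q^{1/r},\qquad \|f\|_{\Phi,Q}=\inf\Big\{\lambda>0:\ \Big\langle\Phi\Big(\frac{|f|}{\lambda}\Big)\Big\rangle_Q\le 1\Big\}.$$ A dyadic grid $\mathscr D$ is a countable collection of cubes such that every $Q\in\mathscr D$ has $\ell(Q)=2^k$ for some $k\in\mathbb Z$, $Q\cap P\in\{\varnothing,P,Q\}$ for all $Q,P\in\mathscr D$, and for each $k\in\mathbb Z$ the cubes of $\mathscr D$ of side length $2^k$ partition $\mathbb R^n$. A subset $\mathcal S\subseteq\mathscr D$ is sparse if $\big|\bigcup_{Q'\in\mathcal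 S,\,Q'\subsetneq Q}Q'\big|\le\frac12|Q|$ for every $Q\in\mathcal S$. For $R\in\mathscr D$ and $f\geq 0$ put $$I_\alpha^{\mathcal S(R)}f(x)=\sum_{Q\in\mathcal S,\,Q\subseteq R}|Q|^{\frac{\alpha}{n}}\langle f\rangle_Q\,\chi_Q(x),$$ and for weights $u,\sigma$ and exponents $1<a\le b<\infty$ define $$[u,\sigma]^{\mathscr D}_{(I_\alpha^{\mathcal S})^{a,b}}=\sup_{R\in\mathscr D}\sigma(R)^{-1/a}\Big(\int_R I_\alpha^{\mathcal S(R)}(\chi_R\sigma)^b\,u\,dx\Big)^{1/b}$$ (in these suprema, and in those below, $0\cdot\infty=0$). (1) Suppose $\frac{p'}{q'}\big(1-\frac{\alpha}{n}\big)\ge 1$. There is $\delta_0>0$, depending only on $n,\alpha,p,q$, such that for every $\delta\ge\delta_0$ there is a constant $C<\infty$, depending only on $n,\alpha,p,q,\delta$, with the following property. Let $$\Phi(t)=t^q\,\big(\log(e+t)\big)^{q-1}\,\big(\log\log(e^e+t)\big)^{q-1+\delta}.$$ If $(u,\sigma)$ is a pair of weights with $$K=\sup_Q|Q|^{\frac{\alpha}{n}+\frac1q-\frac1p}\,\|u^{1/q}\|_{\Phi,Q}\,\|\sigma^{1/p'}\|_{p',Q}<\infty,$$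 the supremum being taken over all cubes $Q$ in $\mathbb R^n$, then for every dyadic grid $\mathscr D$ and every sparse subset $\mathcal S\subseteq\mathscr D$, $$[\sigma,u]^{\mathscr D}_{(I_\alpha^{\mathcal S})^{q',p'}}\le C\,K.$$ (2) Suppose $\frac{q}{p}\big(1-\frac{\alpha}{n}\big)\ge 1$. There is $\delta_0>0$, depending only on $n,\alpha,p,q$, such that for every $\delta\ge\delta_0$ there is a constant $C<\infty$, depending only on $n,\alpha,p,q,\delta$, with the following property. Let $$\Psi(t)=t^{p'}\,\big(\log(e+t)\big)^{p'-1}\,\big(\log\log(e^e+t)\big)^{p'-1+\delta}.$$ If $(u,\sigma)$ is a pair of weights with $$K=\sup_Q|Q|^{\frac{\alpha}{n}+\frac1q-\frac1p}\,\|u^{1/q}\|_{q,Q}\,\|\sigma^{1/p'}\|_{\Psi,Q}<\infty,$$ then for every dyadic grid $\mathscr D$ and every sparse subset $\mathcal S\subseteq\mathscr D$, $$[u,\sigma]^{\mathscr D}_{(I_\alpha^{\mathcal S})^{p,q}}\le C\,K.$$ -/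

import Mathlib

open MeasureTheory
open scoped ENNReal NNReal

namespace DyadicRiesz

noncomputable section

/-- Half-open cubes in `ℝⁿ` with sides parallel to the axes:
`∏ᵢ [corner i, corner i + side)`, with positive side length. -/
structure Cube (n : ℕ) where
  corner : Fin n → ℝ
  side : ℝ
  side_pos : 0 < side

/-- The set of points of a cube. -/
def Cube.toSet {n : ℕ} (Q : Cube n) : Set (Fin n → ℝ) :=
  {x | ∀ i, Q.corner i ≤ x i ∧ x i < Q.corner i + Q.side}

/-- The Lebesgue measure `|Q|`. -/
def Cube.vol {n : ℕ} (Q : Cube n) : ℝ≥0∞ := volume Q.toSet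

/-- The average `⨍_Q f = |Q|⁻¹ ∫_Q f dx` of a nonnegative function. -/
def Cube.avg {n : ℕ} (Q : Cube n) (f : (Fin n → ℝ) → ℝ≥0∞) : ℝ≥0∞ :=
  Q.vol⁻¹ * ∫⁻ x in Q.toSet, f x

/-- A weight: a nonnegative, locally integrable function. -/
def IsWeight {n : ℕ} (w : (Fin n → ℝ) → ℝ) : Prop :=
  (∀ x, 0 ≤ w x) ∧ LocallyIntegrable w volume

/-- The weighted measure `w(E) = ∫_E w dx`. -/
def weightedMeasure {n : ℕ} (w : (Fin n → ℝ) → ℝ) (E : Set (Fin n → ℝ)) : ℝ≥0∞ :=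
  ∫⁻ x in E, ENNReal.ofReal (w x)

/-- The localized Luxemburg norm
`‖f‖_{Φ,Q} = inf {l > 0 : ⨍_Q Φ(|f| / l) ≤ 1}`, equal to `∞` if there is no such `l`. -/
def luxemburgNorm {n : ℕ} (Φ : ℝ → ℝ) (f : (Fin n → ℝ) → ℝ) (Q : Cube n) : ℝ≥0∞ :=
  ⨅ (l : ℝ) (_ : 0 < l ∧ Q.avg (fun x => ENNReal.ofReal (Φ (|f x| / l))) ≤ 1), ENNReal.ofReal l

/-- The localized `Lʳ` norm `‖f‖_{r,Q} = (⨍_Q |f|ʳ)^{1/r}`. -/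
def powerNorm {n : ℕ} (r : ℝ) (f : (Fin n → ℝ) → ℝ) (Q : Cube n) : ℝ≥0∞ :=
  Q.avg (fun x => ENNReal.ofReal (|f x| ^ r)) ^ (1 / r)

/-- The loglog bump `t^r (log(e + t))^{r-1} (log log(e^e + t))^{r-1+δ}`. -/
def loglogBump (r δ t : ℝ) : ℝ :=
  t ^ r * Real.log (Real.exp 1 + t) ^ (r - 1) *
    Real.log (Real.log (Real.exp (Real.exp 1) + t)) ^ (r - 1 + δ)

/-- A dyadic grid: a countable collection of cubes with side lengths `2^k`, any two of them nested
or disjoint, such that for every integer `k` those of side length `2^k` partition `ℝⁿ`. -/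
structure IsDyadicGrid {n : ℕ} (D : Set (Cube n)) : Prop where
  countable : D.Countable
  side_eq : ∀ Q ∈ D, ∃ k : ℤ, Q.side = (2 : ℝ) ^ k
  nested : ∀ Q ∈ D, ∀ P ∈ D, Q.toSet ∩ P.toSet = ∅ ∨ Q.toSet ∩ P.toSet = P.toSet ∨
    Q.toSet ∩ P.toSet = Q.toSet
  partition : ∀ (k : ℤ) (x : Fin n → ℝ), ∃! Q : Cube n, Q ∈ D ∧ Q.side = (2 : ℝ) ^ k ∧ x ∈ Q.toSet

/-- A sparse family: the cubes of the family strictly inside `Q` cover at most half of `Q`. -/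
def IsSparse {n : ℕ} (S : Set (Cube n)) : Prop :=
  ∀ Q ∈ S, volume (⋃ Q' ∈ {Q' | Q' ∈ S ∧ Q'.toSet ⊂ Q.toSet}, Q'.toSet) ≤ (1 / 2 : ℝ≥0∞) * Q.vol

/-- The Riesz potential of a nonnegative function `f` associated with a family `S` of cubes:
`I_α^S f(x) = ∑_{Q ∈ S} |Q|^{α/n} (⨍_Q f) χ_Q(x)`. -/
def dyadicRiesz {n : ℕ} (α : ℝ) (S : Set (Cube n)) (f : (Fin n → ℝ) → ℝ≥0∞)
    (x : Fin n → ℝ) : ℝ≥0∞ :=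
  ∑' Q : S, (Q : Cube n).toSet.indicator
    (fun _ => (Q : Cube n).vol ^ (α / (n : ℝ)) * (Q : Cube n).avg f) x

/-- The subfamily `S(R)` of the cubes of `S` contained in `R`. -/
def localFamily {n : ℕ} (S : Set (Cube n)) (R : Cube n) : Set (Cube n) :=
  {Q | Q ∈ S ∧ Q.toSet ⊆ R.toSet}

/-- The testing constant `[u, σ]^D_{(I_α^S)^{p,q}}`, that is
`sup_{R ∈ D} σ(R)^{-1/p} (∫_R (I_α^{S(R)} (χ_R σ))^q u dx)^{1/q}` (a value in `[0, ∞]`). -/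
def testingConst {n : ℕ} (α p q : ℝ) (D S : Set (Cube n)) (u σ : (Fin n → ℝ) → ℝ) : ℝ≥0∞ :=
  ⨆ R ∈ D, weightedMeasure σ R.toSet ^ (-(1 / p)) *
    (∫⁻ x in R.toSet,
      dyadicRiesz α (localFamily S R) (R.toSet.indicator fun y => ENNReal.ofReal (σ y)) x ^ q *
        ENNReal.ofReal (u x)) ^ (1 / q)

/-- `sup_Q |Q|^{α/n + 1/q - 1/p} N₁(Q) N₂(Q)` over all cubes `Q` in `ℝⁿ`. -/
def bumpConst {n : ℕ} (α p q : ℝ) (N₁ N₂ : Cube n → ℝ≥0∞) : ℝ≥0∞ :=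
  ⨆ Q : Cube n, Q.vol ^ (α / (n : ℝ) + 1 / q - 1 / p) * (N₁ Q * N₂ Q)

end

end DyadicRiesz

open DyadicRiesz

/-! The two statements are dual: replacing `(p, q, u, σ)` by `(q', p', σ, u)` turns (2) into (1), so
only (2) needs proof (`testingConst_le`).

Let `A(Q)` be the two weight characteristic without bump (`localChar`). Since the bump dominates the
power, `A(Q) ≤ K`, and the cubes split into slices `A(Q) ≈ 2^(-a) K`. On slice `a` the bump
condition forces the bump norm of `σ^(1/p')` below `2^(a+1)` times `⟨σ⟩_Q^(1/p')`. The factor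
`log^(p'-1)` of the bump then shows that `σ` has at most a quarter of its mass on `Q` above `2^N
⟨σ⟩_Q`, with `N ≈ 2^(pa)` (`setLIntegral_high_le`). Hence `σ` is spread over about `N` dyadic
levels, which gives the packing bound `∑ σ(Q) ≲ 2^(pa) σ(R)` (`IsLocalFamily.tsum_setLIntegral_le`).

On a slice the hypothesis on `α` makes a suitable power of `|Q|^(α/n) ⟨σ⟩_Q`, times `⟨u⟩_Q`, almost
increasing in `Q`. With sparsity this reduces the `L^q(u)` norm of the sum to the diagonal
(`IsLocalFamily.lintegral_tsum_rpow_le`), where each cube contributes `A(Q)^q σ(Q)^(q/p)`. The slice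
therefore costs `2^(pa) 2^(-qa) K^q σ(R)^(q/p)`, and `p < q` makes the sum over `a` converge. The
loglog factor is used only through being at least `1`. -/

/-! ### Powers of sums along chains. -/

theorem tsum_int_pow_natAbs_ne_top {r : ℝ≥0∞} (hr : r < 1) : ∑' z : ℤ, r ^ z.natAbs ≠ ∞ := by
  have h : ∑' z : ℤ, r ^ z.natAbs = ∑' k : ℕ, r ^ k + ∑' k : ℕ, r ^ (k + 1) := by
    rw [tsum_of_nat_of_neg_add_one ENNReal.summable ENNReal.summable]
    congr 1
  have h0 : ∑' k : ℕ, r ^ k ≠ ∞ := by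
    rw [ENNReal.tsum_geometric]
    exact ENNReal.inv_ne_top.2 (tsub_pos_of_lt hr).ne'
  rw [h]
  simp_rw [pow_succ]
  rw [ENNReal.tsum_mul_right]
  exact ENNReal.add_ne_top.2 ⟨h0, ENNReal.mul_ne_top h0 hr.ne_top⟩

theorem sum_pow_natAbs_sub_le {ι : Type*} (I : Finset ι) {g : ι → ℕ}
    (hg : Set.InjOn g I) (m : ℕ) (r : ℝ≥0∞) :
    ∑ i ∈ I, r ^ ((g i : ℤ) - m).natAbs ≤ ∑' z : ℤ, r ^ z.natAbs := by
  classical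
  have hinj : Set.InjOn (fun i => (g i : ℤ) - m) I := by
    intro i hi j hj h
    exact hg hi hj (by simpa using h)
  rw [← Finset.sum_image (g := fun i => (g i : ℤ) - m) (f := fun z : ℤ => r ^ z.natAbs) hinj]
  exact ENNReal.sum_le_tsum _

/-- The ratio of the geometric sums which bound the `q`-th power of a chain of terms. -/
noncomputable def chainRatio (q : ℝ) : ℝ≥0∞ := (2 / 3 : ℝ≥0∞) ^ (1 / q)

/-- The constant of the chain inequality with exponent `q`. -/
noncomputable def chainConst (q : ℝ) : ℝ≥0∞ := (∑' z : ℤ, chainRatio q ^ z.natAbs) ^ q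

theorem chainConst_ne_top {q : ℝ} (hq : 0 < q) : chainConst q ≠ ∞ := by
  refine ENNReal.rpow_ne_top_of_nonneg hq.le (tsum_int_pow_natAbs_ne_top ?_)
  refine ENNReal.rpow_lt_one ?_ (by positivity)
  rw [ENNReal.div_lt_iff (by simp) (by simp)]
  norm_num

theorem le_of_mul_pow_le {q : ℝ} (hq : 0 < q) {c Φ : ℝ≥0∞} {k : ℕ}
    (h : (3 / 2 : ℝ≥0∞) ^ k * c ^ q ≤ Φ) : c ≤ Φ ^ (1 / q) * chainRatio q ^ k := by
  have h32 : (3 / 2 : ℝ≥0∞)⁻¹ = 2 / 3 := ENNReal.inv_div (by simp) (by simp)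
  have h1 : c ^ q ≤ Φ * (2 / 3 : ℝ≥0∞) ^ k := by
    rw [← h32, ← ENNReal.inv_pow, ← div_eq_mul_inv, ENNReal.le_div_iff_mul_le]
    · rwa [mul_comm]
    · left; simp
    · left; exact ENNReal.pow_ne_top (ENNReal.div_ne_top (by simp) (by simp))
  have h2 : chainRatio q ^ k = ((2 / 3 : ℝ≥0∞) ^ k) ^ (1 / q) := by
    rw [chainRatio, ← ENNReal.rpow_natCast, ← ENNReal.rpow_natCast, ← ENNReal.rpow_mul,
      ← ENNReal.rpow_mul, mul_comm]
  rw [h2, ← ENNReal.mul_rpow_of_nonneg _ _ (by positivity), one_div, ENNReal.le_rpow_inv_iff hq]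
  exact h1

/-- Pair every `i` with an index `m` of the largest term. Whichever of the two has the larger `g`,
the mixed product is at least `c i ^ q`, so `c i` decays geometrically in `|g i - g m|` relative to
the `q`-th root of the double sum. As `g` is injective, these bounds sum to a constant. No convexity
is needed, so every `q > 0` is covered. The base `3/2` is kept below `2` so that the halving of
volumes in a sparse family beats it. -/
theorem sum_rpow_le_sum_chain {ι : Type*} (I : Finset ι) {g : ι → ℕ} (hg : Set.InjOn g I)
    (c : ι → ℝ≥0∞) {s q : ℝ} (hs : 0 ≤ s) (hsq : s ≤ q) (hq : 0 < q) :
    (∑ i ∈ I, c i) ^ q ≤ chainConst q * ∑ j ∈ I, ∑ i ∈ I,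
      if g j ≤ g i then (3 / 2 : ℝ≥0∞) ^ (g i - g j) * (c i ^ s * c j ^ (q - s)) else 0 := by
  rcases I.eq_empty_or_nonempty with rfl | hI
  · simp [hq]
  set Φ := ∑ j ∈ I, ∑ i ∈ I,
      if g j ≤ g i then (3 / 2 : ℝ≥0∞) ^ (g i - g j) * (c i ^ s * c j ^ (q - s)) else 0 with hΦ
  have hterm : ∀ i ∈ I, ∀ j ∈ I, g j ≤ g i →
      (3 / 2 : ℝ≥0∞) ^ (g i - g j) * (c i ^ s * c j ^ (q - s)) ≤ Φ := by
    intro i hi j hj hij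
    have h1 := Finset.single_le_sum (f := fun j => ∑ i ∈ I,
      if g j ≤ g i then (3 / 2 : ℝ≥0∞) ^ (g i - g j) * (c i ^ s * c j ^ (q - s)) else 0)
      (fun _ _ => zero_le) hj
    have h2 := Finset.single_le_sum (f := fun i =>
      if g j ≤ g i then (3 / 2 : ℝ≥0∞) ^ (g i - g j) * (c i ^ s * c j ^ (q - s)) else 0)
      (fun _ _ => zero_le) hi
    simp only [hij, if_true] at h2
    exact h2.trans h1
  obtain ⟨m, hm, hmax⟩ := I.exists_max_image c hI
  have hsplit : ∀ y : ℝ≥0∞, y ^ q = y ^ s * y ^ (q - s) := fun y => by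
    rw [← ENNReal.rpow_add_of_nonneg _ _ hs (sub_nonneg.2 hsq)]; congr 1; ring
  have hci : ∀ i ∈ I, c i ≤ Φ ^ (1 / q) * chainRatio q ^ ((g i : ℤ) - g m).natAbs := by
    intro i hi
    apply le_of_mul_pow_le hq
    rcases le_total (g m) (g i) with h | h
    · have : ((g i : ℤ) - g m).natAbs = g i - g m := by omega
      rw [this, hsplit]
      refine le_trans ?_ (hterm i hi m hm h)
      have hqs : 0 ≤ q - s := sub_nonneg.2 hsq
      gcongr
      exact hmax i hi
    · have : ((g i : ℤ) - g m).natAbs = g m - g i := by omega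
      rw [this, hsplit]
      refine le_trans ?_ (hterm m hm i hi h)
      gcongr
      exact hmax i hi
  have hsum : ∑ i ∈ I, c i ≤ Φ ^ (1 / q) * ∑' z : ℤ, chainRatio q ^ z.natAbs := by
    refine (Finset.sum_le_sum hci).trans ?_
    rw [← Finset.mul_sum]
    gcongr
    exact sum_pow_natAbs_sub_le I hg _ _
  calc (∑ i ∈ I, c i) ^ q ≤ (Φ ^ (1 / q) * ∑' z : ℤ, chainRatio q ^ z.natAbs) ^ q := by gcongr
    _ = chainConst q * Φ := by
      rw [ENNReal.mul_rpow_of_nonneg _ _ hq.le, ← ENNReal.rpow_mul, one_div,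
        inv_mul_cancel₀ hq.ne', ENNReal.rpow_one, mul_comm, chainConst]

theorem tsum_indicator_rpow_le_tsum_chain {ι X : Type*} (E : ι → Set X) {g : ι → ℕ}
    (hg : ∀ x, Set.InjOn g {i | x ∈ E i}) (c : ι → ℝ≥0∞) {s q : ℝ}
    (hs : 0 ≤ s) (hsq : s ≤ q) (hq : 0 < q) (x : X) :
    (∑' i, (E i).indicator (fun _ => c i) x) ^ q ≤ chainConst q * ∑' j, ∑' i,
      if g j ≤ g i then (E i ∩ E j).indicator
        (fun _ => (3 / 2 : ℝ≥0∞) ^ (g i - g j) * (c i ^ s * c j ^ (q - s))) x else 0 := by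
  classical
  rw [← ENNReal.le_rpow_inv_iff hq, ENNReal.tsum_eq_iSup_sum]
  refine iSup_le fun I => ?_
  rw [ENNReal.le_rpow_inv_iff hq]
  have h1 : ∑ i ∈ I, (E i).indicator (fun _ => c i) x = ∑ i ∈ I with x ∈ E i, c i := by
    rw [Finset.sum_filter]
    rfl
  rw [h1]
  refine (sum_rpow_le_sum_chain _ (g := g) (fun i hi j hj => hg x (by simpa using
    (Finset.mem_filter.1 hi).2) (by simpa using (Finset.mem_filter.1 hj).2)) c hs hsq hq).trans ?_
  gcongr
  refine le_trans (Finset.sum_le_sum fun j hj => ?_) (ENNReal.sum_le_tsum (I.filter (x ∈ E ·)))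
  refine le_trans (Finset.sum_le_sum fun i hi => ?_) (ENNReal.sum_le_tsum (I.filter (x ∈ E ·)))
  split_ifs
  · rw [Set.indicator_of_mem]
    exact ⟨(Finset.mem_filter.1 hi).2, (Finset.mem_filter.1 hj).2⟩
  · exact le_rfl

theorem lintegral_tsum_indicator_rpow_le {ι X : Type*} [Countable ι] [MeasurableSpace X]
    (ν : Measure X) {E : ι → Set X} (hE : ∀ i, MeasurableSet (E i)) {g : ι → ℕ}
    (hg : ∀ x, Set.InjOn g {i | x ∈ E i}) (c : ι → ℝ≥0∞) {s q : ℝ}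
    (hs : 0 ≤ s) (hsq : s ≤ q) (hq : 0 < q) :
    ∫⁻ x, (∑' i, (E i).indicator (fun _ => c i) x) ^ q ∂ν ≤ chainConst q * ∑' j, ∑' i,
      if g j ≤ g i then
        (3 / 2 : ℝ≥0∞) ^ (g i - g j) * (c i ^ s * c j ^ (q - s)) * ν (E i ∩ E j) else 0 := by
  refine (lintegral_mono (tsum_indicator_rpow_le_tsum_chain E hg c hs hsq hq)).trans ?_
  have hm : ∀ j i, Measurable fun x => if g j ≤ g i then (E i ∩ E j).indicator
        (fun _ => (3 / 2 : ℝ≥0∞) ^ (g i - g j) * (c i ^ s * c j ^ (q - s))) x else 0 := by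
    intro j i
    split_ifs
    · exact measurable_const.indicator ((hE i).inter (hE j))
    · exact measurable_const
  rw [lintegral_const_mul _ (by fun_prop)]
  gcongr
  rw [lintegral_tsum (fun j => (Measurable.tsum (hm j)).aemeasurable)]
  refine ENNReal.tsum_le_tsum fun j => ?_
  rw [lintegral_tsum (fun i => (hm j i).aemeasurable)]
  refine ENNReal.tsum_le_tsum fun i => ?_
  split_ifs
  · rw [lintegral_indicator_const ((hE i).inter (hE j))]
  · simp

/-- A substitute for Hölder's inequality valid for all `q > 0`: each `t a` is at most `r ^ (-a / q)`
times the `q`-th root of the weighted sum. It is meant for `r > 1`, when the constant is finite. -/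
theorem tsum_rpow_le_tsum_geometric {q : ℝ} (hq : 0 < q) {r : ℝ≥0∞} (hr0 : r ≠ 0) (hr : r ≠ ∞)
    (t : ℕ → ℝ≥0∞) :
    (∑' a, t a) ^ q ≤ (∑' a : ℕ, (r⁻¹ ^ (1 / q)) ^ a) ^ q * ∑' a, r ^ a * t a ^ q := by
  have h1 : ∀ a, t a ≤ (r⁻¹ ^ (1 / q)) ^ a * (∑' a, r ^ a * t a ^ q) ^ (1 / q) := by
    intro a
    have h2 : t a ^ q ≤ (r⁻¹) ^ a * ∑' a, r ^ a * t a ^ q := by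
      refine le_trans ?_ (mul_le_mul_right (ENNReal.le_tsum a) _)
      rw [← mul_assoc, ← mul_pow, ENNReal.inv_mul_cancel hr0 hr]
      simp
    rw [← ENNReal.rpow_natCast, ← ENNReal.rpow_mul, mul_comm (1 / q), ENNReal.rpow_mul,
      ← ENNReal.mul_rpow_of_nonneg _ _ (by positivity), one_div, ENNReal.le_rpow_inv_iff hq,
      ENNReal.rpow_natCast]
    exact h2
  calc (∑' a, t a) ^ q
      ≤ ((∑' a : ℕ, (r⁻¹ ^ (1 / q)) ^ a) * (∑' a, r ^ a * t a ^ q) ^ (1 / q)) ^ q := by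
        rw [← ENNReal.tsum_mul_right]
        gcongr with a
        exact h1 a
    _ = _ := by
      rw [ENNReal.mul_rpow_of_nonneg _ _ hq.le, ← ENNReal.rpow_mul, one_div,
        inv_mul_cancel₀ hq.ne', ENNReal.rpow_one]

namespace DyadicRiesz

variable {n : ℕ}

/-! ### Geometry of cubes and dyadic grids. -/

theorem Cube.toSet_eq_pi (Q : Cube n) :
    Q.toSet = Set.univ.pi fun i => Set.Ico (Q.corner i) (Q.corner i + Q.side) := by
  ext x; simp [Cube.toSet]

theorem Cube.measurableSet_toSet (Q : Cube n) : MeasurableSet Q.toSet := by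
  rw [Q.toSet_eq_pi]
  exact MeasurableSet.univ_pi fun i => measurableSet_Ico

theorem Cube.vol_eq (Q : Cube n) : Q.vol = ENNReal.ofReal Q.side ^ n := by
  rw [Cube.vol, Q.toSet_eq_pi, Real.volume_pi_Ico]
  simp

theorem Cube.vol_ne_zero (Q : Cube n) : Q.vol ≠ 0 := by
  rw [Q.vol_eq]
  exact pow_ne_zero _ (ENNReal.ofReal_pos.2 Q.side_pos).ne'

theorem Cube.vol_ne_top (Q : Cube n) : Q.vol ≠ ∞ := by
  rw [Q.vol_eq]
  exact ENNReal.pow_ne_top ENNReal.ofReal_ne_top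

theorem Cube.corner_mem (Q : Cube n) : Q.corner ∈ Q.toSet :=
  fun i => ⟨le_rfl, by linarith [Q.side_pos]⟩

theorem Cube.side_le_of_subset (hn : n ≠ 0) {Q P : Cube n} (h : Q.toSet ⊆ P.toSet) :
    Q.side ≤ P.side := by
  have h1 : Q.vol ≤ P.vol := measure_mono h
  rw [Q.vol_eq, P.vol_eq, ENNReal.pow_le_pow_left_iff hn] at h1
  exact (ENNReal.ofReal_le_ofReal_iff P.side_pos.le).1 h1

namespace IsDyadicGrid

variable {D : Set (Cube n)}

theorem eq_of_side_eq (hD : IsDyadicGrid D) {Q P : Cube n} (hQ : Q ∈ D) (hP : P ∈ D)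
    {x : Fin n → ℝ} (hxQ : x ∈ Q.toSet) (hxP : x ∈ P.toSet) (h : Q.side = P.side) : Q = P := by
  obtain ⟨k, hk⟩ := hD.side_eq P hP
  exact (hD.partition k x).unique ⟨hQ, h.trans hk, hxQ⟩ ⟨hP, hk, hxP⟩

theorem subset_of_side_le (hD : IsDyadicGrid D) (hn : n ≠ 0) {Q P : Cube n} (hQ : Q ∈ D)
    (hP : P ∈ D) {x : Fin n → ℝ} (hxQ : x ∈ Q.toSet) (hxP : x ∈ P.toSet)
    (h : Q.side ≤ P.side) : Q.toSet ⊆ P.toSet := by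
  rcases hD.nested Q hQ P hP with h1 | h1 | h1
  · exact absurd (show x ∈ Q.toSet ∩ P.toSet from ⟨hxQ, hxP⟩) (by simp [h1])
  · have h2 := Cube.side_le_of_subset hn (Set.inter_eq_right.1 h1)
    rw [hD.eq_of_side_eq hQ hP hxQ hxP (le_antisymm h h2)]
  · exact Set.inter_eq_left.1 h1

theorem ssubset_of_side_lt (hD : IsDyadicGrid D) (hn : n ≠ 0) {Q P : Cube n} (hQ : Q ∈ D)
    (hP : P ∈ D) {x : Fin n → ℝ} (hxQ : x ∈ Q.toSet) (hxP : x ∈ P.toSet)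
    (h : Q.side < P.side) : Q.toSet ⊂ P.toSet := by
  refine ⟨hD.subset_of_side_le hn hQ hP hxQ hxP h.le, fun h' => ?_⟩
  exact absurd (Cube.side_le_of_subset hn h') (not_le.2 h)

end IsDyadicGrid

/-! ### Generations, and packing of volumes in sparse families. -/

/-- The cubes of `F` which strictly contain `Q`. -/
def ancestors (F : Set (Cube n)) (Q : Cube n) : Set (Cube n) :=
  {P | P ∈ F ∧ Q.toSet ⊂ P.toSet}

/-- The generation of `Q` in `F`: the number of cubes of `F` which strictly contain `Q`. -/
noncomputable def generation (F : Set (Cube n)) (Q : Cube n) : ℕ := (ancestors F Q).ncard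

/-- A family of cubes of the grid `D` all of which lie in the cube `R`. -/
structure IsLocalFamily (D F : Set (Cube n)) (R : Cube n) : Prop where
  grid : IsDyadicGrid D
  dim_ne_zero : n ≠ 0
  mem_grid : F ⊆ D
  subset : ∀ Q ∈ F, Q.toSet ⊆ R.toSet

namespace IsLocalFamily

variable {D F : Set (Cube n)} {R : Cube n}

theorem mono (hF : IsLocalFamily D F R) {F' : Set (Cube n)} (h : F' ⊆ F) :
    IsLocalFamily D F' R :=
  ⟨hF.grid, hF.dim_ne_zero, h.trans hF.mem_grid, fun Q hQ => hF.subset Q (h hQ)⟩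

theorem countable (hF : IsLocalFamily D F R) : F.Countable := hF.grid.countable.mono hF.mem_grid

/-- Ancestors have dyadic side lengths between those of `Q` and `R`, and all contain the corner of
`Q`, so there is at most one per scale. -/
theorem finite_ancestors (hF : IsLocalFamily D F R) (Q : Cube n) : (ancestors F Q).Finite := by
  have hlog : ∀ P ∈ F, P.side = (2 : ℝ) ^ Int.log 2 P.side := by
    intro P hP
    obtain ⟨k, hk⟩ := hF.grid.side_eq P (hF.mem_grid hP)
    have : Int.log 2 ((2 : ℝ) ^ k) = k := by
      exact_mod_cast Int.log_zpow (R := ℝ) (b := 2) (by norm_num) k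
    rw [hk, this]
  refine Set.Finite.of_injOn (f := fun P : Cube n => Int.log 2 P.side)
    (t := Set.Icc (Int.log 2 Q.side) (Int.log 2 R.side)) ?_ ?_ (Set.finite_Icc _ _)
  · intro P hP
    exact ⟨Int.log_mono_right Q.side_pos (Cube.side_le_of_subset hF.dim_ne_zero hP.2.1),
      Int.log_mono_right P.side_pos (Cube.side_le_of_subset hF.dim_ne_zero (hF.subset P hP.1))⟩
  · intro P hP P' hP' h
    refine hF.grid.eq_of_side_eq (hF.mem_grid hP.1) (hF.mem_grid hP'.1)
      (hP.2.1 Q.corner_mem) (hP'.2.1 Q.corner_mem) ?_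
    rw [hlog P hP.1, hlog P' hP'.1]
    congr 1

theorem generation_lt (hF : IsLocalFamily D F R) {Q P : Cube n} (hP : P ∈ F)
    (h : Q.toSet ⊂ P.toSet) : generation F P < generation F Q := by
  refine Set.ncard_lt_ncard ⟨fun P' hP' => ⟨hP'.1, h.trans hP'.2⟩, fun h' => ?_⟩
    (hF.finite_ancestors Q)
  exact (h' (show P ∈ ancestors F Q from ⟨hP, h⟩)).2.ne rfl

theorem eq_of_generation_eq (hF : IsLocalFamily D F R) {Q P : Cube n} (hQ : Q ∈ F) (hP : P ∈ F)
    {x : Fin n → ℝ} (hxQ : x ∈ Q.toSet) (hxP : x ∈ P.toSet)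
    (h : generation F Q = generation F P) : Q = P := by
  rcases lt_trichotomy Q.side P.side with h1 | h1 | h1
  · exact absurd h (hF.generation_lt hP (hF.grid.ssubset_of_side_lt hF.dim_ne_zero
      (hF.mem_grid hQ) (hF.mem_grid hP) hxQ hxP h1)).ne'
  · exact hF.grid.eq_of_side_eq (hF.mem_grid hQ) (hF.mem_grid hP) hxQ hxP h1
  · exact absurd h (hF.generation_lt hQ (hF.grid.ssubset_of_side_lt hF.dim_ne_zero
      (hF.mem_grid hP) (hF.mem_grid hQ) hxP hxQ h1)).ne

theorem subset_of_generation_le (hF : IsLocalFamily D F R) {Q P : Cube n} (hQ : Q ∈ F)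
    (hP : P ∈ F) {x : Fin n → ℝ} (hxQ : x ∈ Q.toSet) (hxP : x ∈ P.toSet)
    (h : generation F P ≤ generation F Q) : Q.toSet ⊆ P.toSet := by
  rcases le_or_gt Q.side P.side with h1 | h1
  · exact hF.grid.subset_of_side_le hF.dim_ne_zero (hF.mem_grid hQ) (hF.mem_grid hP) hxQ hxP h1
  · exact absurd h (not_le.2 (hF.generation_lt hQ (hF.grid.ssubset_of_side_lt hF.dim_ne_zero
      (hF.mem_grid hP) (hF.mem_grid hQ) hxP hxQ h1)))

theorem exists_parent (hF : IsLocalFamily D F R) {Q : Cube n} {k : ℕ}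
    (h : generation F Q = k + 1) : ∃ P ∈ F, Q.toSet ⊂ P.toSet ∧ generation F P = k := by
  have hne : (ancestors F Q).Nonempty := by
    by_contra h0
    rw [Set.not_nonempty_iff_eq_empty] at h0
    simp [generation, h0] at h
  -- The ancestors form a chain, and the smallest is the parent: all the others strictly contain it.
  obtain ⟨P, hP, hmin⟩ := (hF.finite_ancestors Q).exists_minimalFor Cube.side _ hne
  refine ⟨P, hP.1, hP.2, ?_⟩
  have heq : ancestors F Q = insert P (ancestors F P) := by
    ext P'
    constructor
    · intro hP'
      have hx := hP.2.1 Q.corner_mem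
      have hx' := hP'.2.1 Q.corner_mem
      rcases le_or_gt P'.side P.side with h1 | h1
      · left
        exact hF.grid.eq_of_side_eq (hF.mem_grid hP'.1) (hF.mem_grid hP.1) hx' hx
          (le_antisymm h1 (hmin hP' h1))
      · right
        exact ⟨hP'.1, hF.grid.ssubset_of_side_lt hF.dim_ne_zero (hF.mem_grid hP.1)
          (hF.mem_grid hP'.1) hx hx' h1⟩
    · rintro (rfl | hP')
      · exact hP
      · exact ⟨hP'.1, hP.2.trans hP'.2⟩
  have h1 : generation F Q = generation F P + 1 := by
    rw [generation, heq, Set.ncard_insert_of_notMem _ (hF.finite_ancestors P)]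
    · rfl
    · exact fun h' => h'.2.ne rfl
  omega

theorem tsum_measure_le_of_generation_eq (hF : IsLocalFamily D F R)
    (μ : Measure (Fin n → ℝ)) (p : Cube n → Prop) [DecidablePred p] {k : ℕ}
    (hp : ∀ Q ∈ F, p Q → generation F Q = k) :
    ∑' Q : F, (if p Q then μ (Q : Cube n).toSet else 0) ≤
      μ (⋃ Q ∈ {Q | Q ∈ F ∧ p Q}, Q.toSet) := by
  have : Countable F := hF.countable.to_subtype
  have h1 : ∀ Q : F, (if p Q then μ (Q : Cube n).toSet else 0) =
      μ (if p Q then (Q : Cube n).toSet else ∅) := by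
    intro Q; split_ifs <;> simp
  simp_rw [h1]
  rw [← measure_iUnion]
  · refine measure_mono (Set.iUnion_subset fun Q => ?_)
    split_ifs with h
    · exact Set.subset_biUnion_of_mem (u := fun Q : Cube n => Q.toSet) ⟨Q.2, h⟩
    · exact Set.empty_subset _
  · intro Q P hQP
    simp only [Function.onFun]
    split_ifs with hQ hP
    · rw [Set.disjoint_left]
      intro x hxQ hxP
      exact hQP (Subtype.ext (hF.eq_of_generation_eq Q.2 P.2 hxQ hxP
        ((hp Q Q.2 hQ).trans (hp P P.2 hP).symm)))
    all_goals simp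
  · intro Q
    split_ifs
    · exact Cube.measurableSet_toSet _
    · exact MeasurableSet.empty

-- Charge each cube to its parent: the children of `P` are disjoint and strictly inside `P`, so
-- sparsity bounds their total volume by `|P| / 2`. The predicate `T` serves both the whole family
-- and the descendants of one cube.
open Classical in
theorem tsum_vol_succ_generation_le (hF : IsLocalFamily D F R) (hS : IsSparse F)
    (T : Cube n → Prop) {k : ℕ}
    (hT : ∀ Q ∈ F, T Q → generation F Q = k + 1 →
      ∃ P ∈ F, T P ∧ Q.toSet ⊂ P.toSet ∧ generation F P = k) :
    ∑' Q : F, (if T Q ∧ generation F Q = k + 1 then (Q : Cube n).vol else 0) ≤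
      2⁻¹ * ∑' Q : F, (if T Q ∧ generation F Q = k then (Q : Cube n).vol else 0) := by
  calc ∑' Q : F, (if T Q ∧ generation F Q = k + 1 then (Q : Cube n).vol else 0)
      ≤ ∑' Q : F, ∑' P : F, (if T P ∧ generation F P = k then
          (if (Q : Cube n).toSet ⊂ (P : Cube n).toSet ∧ generation F Q = k + 1
            then (Q : Cube n).vol else 0) else 0) := by
        refine ENNReal.tsum_le_tsum fun Q => ?_
        split_ifs with h
        · obtain ⟨P, hP, h1, h2, h3⟩ := hT Q Q.2 h.1 h.2
          refine le_trans ?_ (ENNReal.le_tsum ⟨P, hP⟩)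
          simp [h1, h2, h3, h.2]
        · exact zero_le
    _ = ∑' P : F, ∑' Q : F, (if T P ∧ generation F P = k then
          (if (Q : Cube n).toSet ⊂ (P : Cube n).toSet ∧ generation F Q = k + 1
            then (Q : Cube n).vol else 0) else 0) := ENNReal.tsum_comm
    _ ≤ ∑' P : F, 2⁻¹ * (if T P ∧ generation F P = k then (P : Cube n).vol else 0) := by
        refine ENNReal.tsum_le_tsum fun P => ?_
        split_ifs with h
        · refine (hF.tsum_measure_le_of_generation_eq volume (k := k + 1)
            (fun Q => Q.toSet ⊂ (P : Cube n).toSet ∧ generation F Q = k + 1)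
            (fun Q _ h => h.2)).trans ?_
          refine le_trans (measure_mono ?_) ((hS P P.2).trans (by simp))
          exact Set.biUnion_mono (fun Q hQ => ⟨hQ.1, hQ.2.1⟩) (fun _ _ => le_rfl)
        · simp
    _ = _ := ENNReal.tsum_mul_left

open Classical in
theorem tsum_vol_generation_le (hF : IsLocalFamily D F R) (hS : IsSparse F)
    (T : Cube n → Prop) (m : ℕ)
    (hT : ∀ k, m ≤ k → ∀ Q ∈ F, T Q → generation F Q = k + 1 →
      ∃ P ∈ F, T P ∧ Q.toSet ⊂ P.toSet ∧ generation F P = k) (k : ℕ) :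
    ∑' Q : F, (if T Q ∧ generation F Q = m + k then (Q : Cube n).vol else 0) ≤
      2⁻¹ ^ k * ∑' Q : F, (if T Q ∧ generation F Q = m then (Q : Cube n).vol else 0) := by
  induction k with
  | zero => simp
  | succ k ih =>
    refine (hF.tsum_vol_succ_generation_le hS T (hT (m + k) (by omega))).trans ?_
    rw [pow_succ', mul_assoc]
    gcongr

-- Volumes halve per generation while the weight grows by `3/2`; the ratio `3/4` gives the geometric
-- sum `4`.
open Classical in
theorem tsum_weighted_vol_le (hF : IsLocalFamily D F R) (hS : IsSparse F)
    (T : Cube n → Prop) (m : ℕ)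
    (hT : ∀ k, m ≤ k → ∀ Q ∈ F, T Q → generation F Q = k + 1 →
      ∃ P ∈ F, T P ∧ Q.toSet ⊂ P.toSet ∧ generation F P = k) :
    ∑' Q : F, (if T Q ∧ m ≤ generation F Q then
        (3 / 2 : ℝ≥0∞) ^ (generation F Q - m) * (Q : Cube n).vol else 0) ≤
      4 * ∑' Q : F, (if T Q ∧ generation F Q = m then (Q : Cube n).vol else 0) := by
  set V := ∑' Q : F, (if T Q ∧ generation F Q = m then (Q : Cube n).vol else 0)
  have hgeom : ∑' k : ℕ, ((3 / 2 : ℝ≥0∞) * 2⁻¹) ^ k = 4 := by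
    have h34 : (3 / 2 : ℝ≥0∞) * 2⁻¹ = ENNReal.ofReal (3 / 4) := by
      rw [show (3 / 4 : ℝ) = 3 / 2 * 2⁻¹ by norm_num, ENNReal.ofReal_mul (by norm_num),
        ENNReal.ofReal_div_of_pos (by norm_num), ENNReal.ofReal_inv_of_pos (by norm_num)]
      simp
    rw [ENNReal.tsum_geometric, h34, ← ENNReal.ofReal_one, ← ENNReal.ofReal_sub _ (by norm_num),
      ← ENNReal.ofReal_inv_of_pos (by norm_num)]
    norm_num
  calc ∑' Q : F, (if T Q ∧ m ≤ generation F Q then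
        (3 / 2 : ℝ≥0∞) ^ (generation F Q - m) * (Q : Cube n).vol else 0)
      ≤ ∑' Q : F, ∑' k : ℕ, (3 / 2 : ℝ≥0∞) ^ k *
          (if T Q ∧ generation F Q = m + k then (Q : Cube n).vol else 0) := by
        refine ENNReal.tsum_le_tsum fun Q => ?_
        split_ifs with h
        · refine le_trans ?_ (ENNReal.le_tsum (generation F Q - m))
          rw [if_pos ⟨h.1, by omega⟩]
        · exact zero_le
    _ = ∑' k : ℕ, (3 / 2 : ℝ≥0∞) ^ k * ∑' Q : F,
          (if T Q ∧ generation F Q = m + k then (Q : Cube n).vol else 0) := by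
        rw [ENNReal.tsum_comm]
        simp_rw [ENNReal.tsum_mul_left]
    _ ≤ ∑' k : ℕ, ((3 / 2 : ℝ≥0∞) * 2⁻¹) ^ k * V := by
        refine ENNReal.tsum_le_tsum fun k => ?_
        rw [mul_pow, mul_assoc]
        gcongr
        exact hF.tsum_vol_generation_le hS T m hT k
    _ = 4 * V := by rw [ENNReal.tsum_mul_right, hgeom]

open Classical in
theorem tsum_weighted_vol_descendants_le (hF : IsLocalFamily D F R) (hS : IsSparse F)
    {P : Cube n} (hP : P ∈ F) :
    ∑' Q : F, (if (Q : Cube n).toSet ⊆ P.toSet ∧ generation F P ≤ generation F Q then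
        (3 / 2 : ℝ≥0∞) ^ (generation F Q - generation F P) * (Q : Cube n).vol else 0) ≤
      4 * P.vol := by
  refine (hF.tsum_weighted_vol_le hS (fun Q => Q.toSet ⊆ P.toSet) (generation F P) ?_).trans ?_
  · intro k hk Q hQ hQP hg
    obtain ⟨P', hP', h1, h2⟩ := hF.exists_parent hg
    exact ⟨P', hP', hF.subset_of_generation_le hP' hP (h1.1 Q.corner_mem) (hQP Q.corner_mem)
      (h2 ▸ hk), h1, h2⟩
  · gcongr
    -- A cube inside `P` of the same generation is `P` itself.
    rw [tsum_eq_single (⟨P, hP⟩ : F)]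
    · simp
    · intro Q hQ
      rw [if_neg]
      rintro ⟨h1, h2⟩
      exact hQ (Subtype.ext (hF.eq_of_generation_eq Q.2 hP (Q : Cube n).corner_mem
        (h1 (Q : Cube n).corner_mem) h2))

open Classical in
theorem tsum_vol_le (hF : IsLocalFamily D F R) (hS : IsSparse F) :
    ∑' Q : F, (Q : Cube n).vol ≤
      4 * ∑' Q : F, (if generation F Q = 0 then (Q : Cube n).vol else 0) := by
  have h := hF.tsum_weighted_vol_le hS (fun _ => True) 0 (fun k _ Q _ _ hg => by
    obtain ⟨P', hP', h1, h2⟩ := hF.exists_parent hg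
    exact ⟨P', hP', trivial, h1, h2⟩)
  simp only [true_and, zero_le, if_true] at h
  refine le_trans (ENNReal.tsum_le_tsum fun Q => ?_) h
  refine le_mul_of_one_le_left (zero_le) (one_le_pow₀ ?_)
  rw [ENNReal.le_div_iff_mul_le (by simp) (by simp)]
  norm_num

end IsLocalFamily

theorem IsSparse.mono {F F' : Set (Cube n)} (hF : IsSparse F) (h : F' ⊆ F) : IsSparse F' := by
  intro Q hQ
  refine le_trans (measure_mono ?_) (hF Q (h hQ))
  exact Set.biUnion_subset_biUnion_left fun _ hQ' => ⟨h hQ'.1, hQ'.2⟩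

/-! ### Packing of a weight by dyadic levels. -/

theorem Cube.vol_mul_avg (Q : Cube n) (f : (Fin n → ℝ) → ℝ≥0∞) :
    Q.vol * Q.avg f = ∫⁻ x in Q.toSet, f x := by
  rw [Cube.avg, ← mul_assoc, ENNReal.mul_inv_cancel Q.vol_ne_zero Q.vol_ne_top, one_mul]

theorem Cube.avg_ne_top {Q : Cube n} {f : (Fin n → ℝ) → ℝ≥0∞}
    (h : ∫⁻ x in Q.toSet, f x ≠ ∞) : Q.avg f ≠ ∞ :=
  ENNReal.mul_ne_top (ENNReal.inv_ne_top.2 Q.vol_ne_zero) h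

theorem Cube.avg_congr_ae (Q : Cube n) {f g : (Fin n → ℝ) → ℝ≥0∞} (h : f =ᵐ[volume] g) :
    Q.avg f = Q.avg g := by
  rw [Cube.avg, Cube.avg, lintegral_congr_ae (ae_restrict_of_ae h)]

/-- The points where `f` is comparable to `2 ^ m` from below, and at most `2 ^ (N + m + 1)`. -/
def levelBand (f : (Fin n → ℝ) → ℝ≥0∞) (N : ℕ) (m : ℤ) : Set (Fin n → ℝ) :=
  {x | (2 : ℝ≥0∞) ^ m < 4 * f x ∧ f x ≤ 2 ^ N * 2 ^ (m + 1)}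

theorem measurableSet_levelBand {f : (Fin n → ℝ) → ℝ≥0∞} (hf : Measurable f) (N : ℕ) (m : ℤ) :
    MeasurableSet (levelBand f N m) :=
  (measurableSet_lt measurable_const (hf.const_mul 4)).inter
    (measurableSet_le hf measurable_const)

theorem two_zpow_mul (a b : ℤ) : (2 : ℝ≥0∞) ^ a * 2 ^ b = 2 ^ (a + b) :=
  (ENNReal.zpow_add (by norm_num) (by norm_num) a b).symm

theorem lt_of_two_zpow_lt {a b : ℤ} (h : (2 : ℝ≥0∞) ^ a < 2 ^ b) : a < b := by
  by_contra hab
  exact absurd (ENNReal.zpow_le_of_le (by norm_num) (not_lt.1 hab)) (not_le.2 h)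

/-- If `2 ^ k ≤ f x < 2 ^ (k + 1)`, then `x` lies in band `m` only for `k - N - 1 ≤ m ≤ k + 2`,
which is `N + 4` values. -/
theorem tsum_indicator_levelBand_le (f : (Fin n → ℝ) → ℝ≥0∞) (N : ℕ) (x : Fin n → ℝ) :
    ∑' m : ℤ, (levelBand f N m).indicator f x ≤ (N + 4) * f x := by
  by_cases h0 : f x = 0
  · have : ∀ m : ℤ, (levelBand f N m).indicator f x = 0 := fun m =>
      (Set.indicator_apply_eq_zero).2 fun _ => h0
    simp [this]
  by_cases htop : f x = ∞
  · rw [htop, ENNReal.mul_top (by simp)]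
    exact le_top
  obtain ⟨k, hk1, hk2⟩ := ENNReal.exists_mem_Ico_zpow (y := 2) h0 htop (by norm_num) (by norm_num)
  rw [tsum_eq_sum (s := Finset.Icc (k - N - 1) (k + 2))]
  · refine (Finset.sum_le_card_nsmul _ _ (f x) fun m _ => Set.indicator_le_self _ _ _).trans ?_
    rw [Int.card_Icc, nsmul_eq_mul]
    gcongr
    have : (k + 2 + 1 - (k - N - 1)).toNat = N + 4 := by omega
    rw [this]
    push_cast
    exact le_rfl
  · intro m hm
    refine Set.indicator_of_notMem (fun hx => hm ?_) _
    obtain ⟨h1, h2⟩ := hx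
    have h3 : m < 2 + (k + 1) := by
      apply lt_of_two_zpow_lt
      rw [← two_zpow_mul]
      refine h1.trans ?_
      rw [show (2 : ℝ≥0∞) ^ (2 : ℤ) = 4 by norm_cast]
      exact ENNReal.mul_lt_mul_right (by norm_num) (by norm_num) hk2
    have h4 : k < N + (m + 1) + 1 := by
      apply lt_of_two_zpow_lt
      rw [← two_zpow_mul, ← two_zpow_mul, zpow_natCast]
      refine (hk1.trans h2).trans_lt ?_
      have h5 : (2 : ℝ≥0∞) ^ N * 2 ^ (m + 1) ≠ 0 :=
        mul_ne_zero (by simp) (ENNReal.zpow_pos (by norm_num) (by norm_num) _).ne'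
      have h6 : (2 : ℝ≥0∞) ^ N * 2 ^ (m + 1) ≠ ∞ :=
        ENNReal.mul_ne_top (by simp) (ENNReal.zpow_ne_top (by norm_num) (by norm_num) _)
      calc (2 : ℝ≥0∞) ^ N * 2 ^ (m + 1) = 2 ^ N * 2 ^ (m + 1) * 1 := (mul_one _).symm
        _ < 2 ^ N * 2 ^ (m + 1) * 2 ^ (1 : ℤ) :=
          ENNReal.mul_lt_mul_right h5 h6 (by norm_num)
    rw [Finset.mem_Icc]
    omega

/-- Points with `f ≤ 2 ^ m / 4` carry at most a quarter of the mass because the average is at least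
`2 ^ m`, and the high points another quarter by hypothesis. The band keeps at least half. -/
theorem setLIntegral_le_two_mul_levelBand {f : (Fin n → ℝ) → ℝ≥0∞} {N : ℕ} {m : ℤ} {Q : Cube n}
    (hfin : ∫⁻ x in Q.toSet, f x ≠ ∞)
    (hhigh : ∫⁻ x in Q.toSet ∩ {x | 2 ^ N * Q.avg f < f x}, f x ≤ 4⁻¹ * ∫⁻ x in Q.toSet, f x)
    (h1 : 2 ^ m ≤ Q.avg f) (h2 : Q.avg f < 2 ^ (m + 1)) :
    ∫⁻ x in Q.toSet, f x ≤ 2 * ∫⁻ x in Q.toSet ∩ levelBand f N m, f x := by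
  set I := ∫⁻ x in Q.toSet, f x with hI
  have hsub : Q.toSet ⊆ (Q.toSet ∩ {x | 2 ^ N * Q.avg f < f x}) ∪
      ((Q.toSet ∩ {x | 4 * f x ≤ 2 ^ m}) ∪ (Q.toSet ∩ levelBand f N m)) := by
    intro x hx
    by_cases hh : 2 ^ N * Q.avg f < f x
    · exact Or.inl ⟨hx, hh⟩
    · by_cases hl : 4 * f x ≤ 2 ^ m
      · exact Or.inr (Or.inl ⟨hx, hl⟩)
      · refine Or.inr (Or.inr ⟨hx, not_le.1 hl, (not_lt.1 hh).trans ?_⟩)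
        gcongr
  have hlow : ∫⁻ x in Q.toSet ∩ {x | 4 * f x ≤ 2 ^ m}, f x ≤ 4⁻¹ * I := by
    calc ∫⁻ x in Q.toSet ∩ {x | 4 * f x ≤ 2 ^ m}, f x
        ≤ ∫⁻ _ in Q.toSet ∩ {x | 4 * f x ≤ 2 ^ m}, 4⁻¹ * Q.avg f := by
          refine setLIntegral_mono measurable_const fun x hx => ?_
          rw [← ENNReal.div_eq_inv_mul, ENNReal.le_div_iff_mul_le (by simp) (by simp), mul_comm]
          exact le_trans hx.2 h1
      _ ≤ 4⁻¹ * Q.avg f * Q.vol := by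
          rw [setLIntegral_const]
          gcongr
          exact measure_mono Set.inter_subset_left
      _ = 4⁻¹ * I := by rw [mul_assoc, mul_comm (Q.avg f), Q.vol_mul_avg]
  have hle : I ≤ 4⁻¹ * I + (4⁻¹ * I + ∫⁻ x in Q.toSet ∩ levelBand f N m, f x) := by
    refine (lintegral_mono_set hsub).trans ?_
    refine (lintegral_union_le _ _ _).trans ?_
    gcongr
    refine (lintegral_union_le _ _ _).trans ?_
    gcongr
  lift I to ℝ≥0 using hfin with I'
  by_cases hmid : ∫⁻ x in Q.toSet ∩ levelBand f N m, f x = ∞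
  · rw [hmid]; simp
  lift ∫⁻ x in Q.toSet ∩ levelBand f N m, f x to ℝ≥0 using hmid with M
  have h4 : (4 : ℝ≥0∞)⁻¹ = ((4⁻¹ : ℝ≥0) : ℝ≥0∞) := by
    rw [ENNReal.coe_inv (by norm_num)]; rfl
  rw [h4] at hle
  norm_cast at hle ⊢
  rw [← NNReal.coe_le_coe] at hle ⊢
  push_cast at hle ⊢
  linarith

-- Sort the cubes by the dyadic size `2 ^ m` of their average. At a fixed level mass is comparable
-- to volume, so sparsity reduces the sum to the maximal cubes; these are disjoint and have half
-- their mass in band `m`. The bands overlap at most `N + 4` times. The factor `16` is `4` from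
-- sparsity, `2` from the width of the level and `2` from the half mass.
open Classical in
theorem IsLocalFamily.tsum_setLIntegral_le {D F : Set (Cube n)} {R : Cube n}
    (hF : IsLocalFamily D F R) (hS : IsSparse F) {f : (Fin n → ℝ) → ℝ≥0∞} (hf : Measurable f)
    (hfin : ∫⁻ x in R.toSet, f x ≠ ∞) (hpos : ∀ Q ∈ F, Q.avg f ≠ 0) (N : ℕ)
    (hhigh : ∀ Q ∈ F, ∫⁻ x in Q.toSet ∩ {x | 2 ^ N * Q.avg f < f x}, f x ≤
      4⁻¹ * ∫⁻ x in Q.toSet, f x) :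
    ∑' Q : F, ∫⁻ x in (Q : Cube n).toSet, f x ≤ 16 * ((N + 4) * ∫⁻ x in R.toSet, f x) := by
  have hfinQ : ∀ Q ∈ F, ∫⁻ x in Q.toSet, f x ≠ ∞ := fun Q hQ =>
    ne_top_of_le_ne_top hfin (lintegral_mono_set (hF.subset Q hQ))
  set G : ℤ → Set (Cube n) := fun m => {Q | Q ∈ F ∧ 2 ^ m ≤ Q.avg f ∧ Q.avg f < 2 ^ (m + 1)}
    with hG
  have hcover : F ⊆ ⋃ m, G m := by
    intro Q hQ
    obtain ⟨k, hk1, hk2⟩ := ENNReal.exists_mem_Ico_zpow (y := 2) (hpos Q hQ)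
      (Cube.avg_ne_top (hfinQ Q hQ)) (by norm_num) (by norm_num)
    exact Set.mem_iUnion.2 ⟨k, hQ, hk1, hk2⟩
  have hlevel : ∀ m, ∑' Q : G m, ∫⁻ x in (Q : Cube n).toSet, f x ≤
      16 * ∫⁻ x in R.toSet, (levelBand f N m).indicator f x := by
    intro m
    have hGF : G m ⊆ F := fun Q hQ => hQ.1
    have hGm := hF.mono hGF
    set μ := (volume.withDensity f).restrict (levelBand f N m) with hμ
    have hμQ : ∀ Q : Cube n, μ Q.toSet = ∫⁻ x in Q.toSet ∩ levelBand f N m, f x := by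
      intro Q
      rw [hμ, Measure.restrict_apply Q.measurableSet_toSet, withDensity_apply _
        (Q.measurableSet_toSet.inter (measurableSet_levelBand hf N m))]
    calc ∑' Q : G m, ∫⁻ x in (Q : Cube n).toSet, f x
        ≤ ∑' Q : G m, 2 ^ (m + 1) * (Q : Cube n).vol := by
          refine ENNReal.tsum_le_tsum fun Q => ?_
          rw [← Cube.vol_mul_avg, mul_comm]
          gcongr
          exact Q.2.2.2.le
      _ ≤ 2 ^ (m + 1) *
          (4 * ∑' Q : G m, (if generation (G m) Q = 0 then (Q : Cube n).vol else 0)) := by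
          rw [ENNReal.tsum_mul_left]
          gcongr
          exact hGm.tsum_vol_le (hS.mono hGF)
      _ = 8 * ∑' Q : G m, (if generation (G m) Q = 0 then 2 ^ m * (Q : Cube n).vol else 0) := by
          rw [← two_zpow_mul, zpow_one, mul_comm (2 ^ m), mul_assoc, mul_left_comm _ 4, ← mul_assoc,
            ← ENNReal.tsum_mul_left]
          simp only [mul_ite, mul_zero]
          congr 1
          norm_num
      _ ≤ 8 * ∑' Q : G m, 2 * (if generation (G m) Q = 0 then μ (Q : Cube n).toSet else 0) := by
          gcongr with Q
          split_ifs
          · rw [hμQ]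
            refine le_trans ?_ (setLIntegral_le_two_mul_levelBand (hfinQ Q Q.2.1)
              (hhigh Q Q.2.1) Q.2.2.1 Q.2.2.2)
            rw [← Cube.vol_mul_avg, mul_comm]
            gcongr
            exact Q.2.2.1
          · simp
      _ ≤ 8 * (2 * μ R.toSet) := by
          rw [ENNReal.tsum_mul_left]
          gcongr
          refine (hGm.tsum_measure_le_of_generation_eq μ (fun Q => generation (G m) Q = 0)
            (fun Q _ h => h)).trans (measure_mono ?_)
          exact Set.iUnion₂_subset fun Q hQ => hGm.subset Q hQ.1
      _ = 16 * ∫⁻ x in R.toSet, (levelBand f N m).indicator f x := by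
          rw [hμQ, ← mul_assoc, setLIntegral_indicator (measurableSet_levelBand hf N m),
            Set.inter_comm]
          norm_num
  calc ∑' Q : F, ∫⁻ x in (Q : Cube n).toSet, f x
      ≤ ∑' Q : ⋃ m, G m, ∫⁻ x in (Q : Cube n).toSet, f x :=
        ENNReal.tsum_mono_subtype (fun Q : Cube n => ∫⁻ x in Q.toSet, f x) hcover
    _ ≤ ∑' m, ∑' Q : G m, ∫⁻ x in (Q : Cube n).toSet, f x :=
        ENNReal.tsum_iUnion_le_tsum (fun Q : Cube n => ∫⁻ x in Q.toSet, f x) G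
    _ ≤ ∑' m, 16 * ∫⁻ x in R.toSet, (levelBand f N m).indicator f x :=
        ENNReal.tsum_le_tsum hlevel
    _ = 16 * ∫⁻ x in R.toSet, ∑' m, (levelBand f N m).indicator f x := by
        rw [ENNReal.tsum_mul_left, lintegral_tsum]
        exact fun m => (hf.indicator (measurableSet_levelBand hf N m)).aemeasurable
    _ ≤ 16 * ∫⁻ x in R.toSet, (N + 4) * f x := by
        gcongr with x
        exact tsum_indicator_levelBand_le f N x
    _ = 16 * ((N + 4) * ∫⁻ x in R.toSet, f x) := by
        rw [lintegral_const_mul _ hf]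

/-! ### What the bump says about the high part of the weight. -/

theorem rpow_mul_log_rpow_le_loglogBump {r δ t : ℝ} (hr : 1 < r) (hδ : 0 ≤ δ) (ht : 0 ≤ t) :
    t ^ r * Real.log (Real.exp 1 + t) ^ (r - 1) ≤ loglogBump r δ t := by
  have h1 : 1 ≤ Real.log (Real.exp 1 + t) := by
    rw [Real.le_log_iff_exp_le (by positivity)]; linarith
  have h2 : 1 ≤ Real.log (Real.log (Real.exp (Real.exp 1) + t)) := by
    have h3 : Real.exp 1 ≤ Real.log (Real.exp (Real.exp 1) + t) := by
      rw [Real.le_log_iff_exp_le (by positivity)]; linarith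
    rwa [Real.le_log_iff_exp_le ((Real.exp_pos 1).trans_le h3)]
  refine le_mul_of_one_le_right (by positivity) (Real.one_le_rpow h2 (by linarith))

theorem rpow_le_loglogBump {r δ t : ℝ} (hr : 1 < r) (hδ : 0 ≤ δ) (ht : 0 ≤ t) :
    t ^ r ≤ loglogBump r δ t := by
  refine le_trans ?_ (rpow_mul_log_rpow_le_loglogBump hr hδ ht)
  have h1 : 1 ≤ Real.log (Real.exp 1 + t) := by
    rw [Real.le_log_iff_exp_le (by positivity)]; linarith
  exact le_mul_of_one_le_right (by positivity) (Real.one_le_rpow h1 (by linarith))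

/-- Above height `2 ^ N * A` the argument `t` of the bump is at least `2 ^ (N / p') / L`, so its
logarithm is of order `N`. The size of `N` makes `log ^ (p' - 1)` absorb both `L ^ p'`, lost in
comparing `l ^ p'` with `A`, and the factor `4`. -/
theorem le_loglogBump_of_lt {p p' δ L l A s : ℝ} {N : ℕ} (hp : p.HolderConjugate p')
    (hδ : 0 ≤ δ) (hL : 1 ≤ L) (hN : 4 * p' * 4 ^ (p - 1) * L ^ p ≤ N) (hl : 0 < l) (hA : 0 < A)
    (hlA : l < L * A ^ (1 / p')) (hs : 2 ^ N * A < s) :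
    s ≤ 4⁻¹ * A * loglogBump p' δ (s ^ (1 / p') / l) := by
  have hp1 := hp.lt
  have hp'1 := hp.symm.lt
  have hp'0 : 0 < p' := by linarith
  have hs0 : 0 < s := lt_trans (by positivity) hs
  set t := s ^ (1 / p') / l with ht
  have ht0 : 0 < t := by positivity
  have hLN : 4 * p' * L ≤ N := by
    refine le_trans ?_ hN
    have h1 : (1 : ℝ) ≤ 4 ^ (p - 1) := Real.one_le_rpow (by norm_num) (by linarith)
    have h2 : L ≤ L ^ p := by
      simpa using Real.rpow_le_rpow_of_exponent_le hL hp1.le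
    calc 4 * p' * L ≤ 4 * p' * L ^ p := by gcongr
      _ = 4 * p' * 1 * L ^ p := by ring
      _ ≤ _ := by gcongr
  have hN0 : (0 : ℝ) < N := lt_of_lt_of_le (by positivity) hLN
  have htL : (2 ^ N : ℝ) ^ (1 / p') / L ≤ t := by
    rw [ht, div_le_div_iff₀ (by positivity) hl]
    calc (2 ^ N : ℝ) ^ (1 / p') * l ≤ (2 ^ N : ℝ) ^ (1 / p') * (L * A ^ (1 / p')) := by gcongr
      _ = (2 ^ N * A) ^ (1 / p') * L := by
        rw [Real.mul_rpow (by positivity) hA.le]; ring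
      _ ≤ s ^ (1 / p') * L := by gcongr
  have hlog : N / (4 * p') ≤ Real.log (Real.exp 1 + t) := by
    have h1 : Real.log ((2 ^ N : ℝ) ^ (1 / p') / L) ≤ Real.log (Real.exp 1 + t) := by
      apply Real.log_le_log (by positivity)
      linarith [Real.exp_pos 1]
    rw [Real.log_div (by positivity) (by positivity), Real.log_rpow (by positivity),
      Real.log_pow] at h1
    have h2 : Real.log L ≤ L := (Real.log_le_sub_one_of_pos (by linarith)).trans (by linarith)
    have h3 : L ≤ N / (4 * p') := by
      rw [le_div_iff₀ (by positivity)]; linarith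
    have h4 : (2 : ℝ) * (N / (4 * p')) ≤ 1 / p' * (N * Real.log 2) := by
      have : (2 : ℝ) * (N / (4 * p')) = 1 / p' * (N * (1 / 2)) := by field_simp; norm_num
      rw [this]
      gcongr
      linarith [Real.log_two_gt_d9]
    linarith
  have hbump := rpow_mul_log_rpow_le_loglogBump hp'1 hδ ht0.le
  have htp : t ^ p' = s / l ^ p' := by
    rw [ht, Real.div_rpow (by positivity) hl.le, ← Real.rpow_mul hs0.le, one_div,
      inv_mul_cancel₀ hp'0.ne', Real.rpow_one]
  have hlp : l ^ p' ≤ L ^ p' * A := by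
    calc l ^ p' ≤ (L * A ^ (1 / p')) ^ p' := by gcongr
      _ = L ^ p' * A := by
        rw [Real.mul_rpow (by positivity) (by positivity), ← Real.rpow_mul hA.le, one_div,
          inv_mul_cancel₀ hp'0.ne', Real.rpow_one]
  -- The power `L ^ p` in `hN` comes from `(p - 1) * (p' - 1) = 1`: raising `4 ^ (p - 1) * L ^ p` to
  -- the power `p' - 1` gives exactly `4 * L ^ p'`.
  have hNL : 4 * L ^ p' ≤ (N / (4 * p')) ^ (p' - 1) := by
    have h1 : 4 ^ (p - 1) * L ^ p ≤ N / (4 * p') := by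
      rw [le_div_iff₀ (by positivity)]; linarith
    have e0 := hp.mul_eq_add
    have e1 : (p - 1) * (p' - 1) = 1 := by linarith
    have e2 : p * (p' - 1) = p' := by linarith
    calc 4 * L ^ p' = (4 ^ (p - 1) * L ^ p) ^ (p' - 1) := by
          rw [Real.mul_rpow (by positivity) (by positivity), ← Real.rpow_mul (by norm_num),
            ← Real.rpow_mul (by positivity), e1, e2, Real.rpow_one]
      _ ≤ _ := by
        apply Real.rpow_le_rpow (by positivity) h1 (by linarith)
  have hkey : 4 * L ^ p' ≤ Real.log (Real.exp 1 + t) ^ (p' - 1) :=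
    hNL.trans (Real.rpow_le_rpow (by positivity) hlog (by linarith))
  calc s = 4⁻¹ * A * (s / (L ^ p' * A) * (4 * L ^ p')) := by
        field_simp
    _ ≤ 4⁻¹ * A * (s / l ^ p' * Real.log (Real.exp 1 + t) ^ (p' - 1)) := by gcongr
    _ ≤ _ := by
        rw [← htp]
        gcongr

theorem setLIntegral_high_le {p p' δ L : ℝ} {N : ℕ} (hp : p.HolderConjugate p')
    (hδ : 0 ≤ δ) (hL : 1 ≤ L) (hN : 4 * p' * 4 ^ (p - 1) * L ^ p ≤ N)
    {σ : (Fin n → ℝ) → ℝ} (hσ : ∀ x, 0 ≤ σ x) {f : (Fin n → ℝ) → ℝ≥0∞} (hf : Measurable f)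
    (hfσ : f =ᵐ[volume] fun x => ENNReal.ofReal (σ x)) {Q : Cube n}
    (h0 : Q.avg f ≠ 0) (htop : Q.avg f ≠ ∞)
    (hlux : luxemburgNorm (loglogBump p' δ) (fun x => σ x ^ (1 / p')) Q <
      ENNReal.ofReal L * Q.avg f ^ (1 / p')) :
    ∫⁻ x in Q.toSet ∩ {x | 2 ^ N * Q.avg f < f x}, f x ≤ 4⁻¹ * ∫⁻ x in Q.toSet, f x := by
  -- The strict inequality provides an admissible `l` below the bound, even if the infimum is not
  -- attained.
  obtain ⟨l, hl⟩ := iInf_lt_iff.1 hlux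
  obtain ⟨⟨hl0, hlavg⟩, hlL⟩ := iInf_lt_iff.1 hl
  set A := (Q.avg f).toReal with hA
  have hAeq : Q.avg f = ENNReal.ofReal A := (ENNReal.ofReal_toReal htop).symm
  have hA0 : 0 < A := ENNReal.toReal_pos h0 htop
  have hlA : l < L * A ^ (1 / p') := by
    rw [hAeq, ENNReal.ofReal_rpow_of_pos hA0, ← ENNReal.ofReal_mul (by linarith)] at hlL
    exact (ENNReal.ofReal_lt_ofReal_iff (by positivity)).1 hlL
  calc ∫⁻ x in Q.toSet ∩ {x | 2 ^ N * Q.avg f < f x}, f x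
      ≤ ∫⁻ x in Q.toSet ∩ {x | 2 ^ N * Q.avg f < f x},
          4⁻¹ * Q.avg f * ENNReal.ofReal (loglogBump p' δ (|σ x ^ (1 / p')| / l)) := by
        refine setLIntegral_mono_ae' (Q.measurableSet_toSet.inter
          (measurableSet_lt measurable_const hf)) ?_
        filter_upwards [hfσ] with x hx hxQ
        have hxs : 2 ^ N * A < σ x := by
          have h1 : 2 ^ N * Q.avg f < f x := hxQ.2
          rw [hx, hAeq, show (2 : ℝ≥0∞) ^ N = ENNReal.ofReal (2 ^ N) by
            rw [ENNReal.ofReal_pow (by norm_num)]; simp, ← ENNReal.ofReal_mul (by positivity)] at h1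
          exact (ENNReal.ofReal_lt_ofReal_iff_of_nonneg (by positivity)).1 h1
        have h2 := le_loglogBump_of_lt hp hδ hL hN hl0 hA0 hlA hxs
        rw [hx, abs_of_nonneg (Real.rpow_nonneg (hσ x) _), hAeq,
          show (4⁻¹ : ℝ≥0∞) = ENNReal.ofReal 4⁻¹ by
            rw [ENNReal.ofReal_inv_of_pos (by norm_num)]; simp,
          ← ENNReal.ofReal_mul (by norm_num), ← ENNReal.ofReal_mul (by positivity)]
        exact ENNReal.ofReal_le_ofReal h2
    _ ≤ ∫⁻ x in Q.toSet,
          4⁻¹ * Q.avg f * ENNReal.ofReal (loglogBump p' δ (|σ x ^ (1 / p')| / l)) :=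
        lintegral_mono_set Set.inter_subset_left
    _ = 4⁻¹ * Q.avg f *
          (Q.vol * Q.avg fun x => ENNReal.ofReal (loglogBump p' δ (|σ x ^ (1 / p')| / l))) := by
        rw [lintegral_const_mul' _ _ (ENNReal.mul_ne_top (by simp) htop), Q.vol_mul_avg]
    _ ≤ 4⁻¹ * Q.avg f * (Q.vol * 1) := by gcongr
    _ = 4⁻¹ * ∫⁻ x in Q.toSet, f x := by
        rw [mul_one, mul_assoc, mul_comm (Q.avg f), Q.vol_mul_avg]

theorem avg_rpow_le_luxemburgNorm {r δ : ℝ} (hr : 1 < r) (hδ : 0 ≤ δ)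
    {σ : (Fin n → ℝ) → ℝ} (hσ : ∀ x, 0 ≤ σ x) (Q : Cube n) :
    (Q.avg fun x => ENNReal.ofReal (σ x)) ^ (1 / r) ≤
      luxemburgNorm (loglogBump r δ) (fun x => σ x ^ (1 / r)) Q := by
  refine le_iInf₂ fun l hl => ?_
  have hr0 : 0 < r := by linarith
  rw [one_div, ENNReal.rpow_inv_le_iff hr0, ENNReal.ofReal_rpow_of_pos hl.1]
  calc (Q.avg fun x => ENNReal.ofReal (σ x))
      ≤ Q.avg fun x => ENNReal.ofReal (l ^ r) *
          ENNReal.ofReal (loglogBump r δ (|σ x ^ (1 / r)| / l)) := by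
        unfold Cube.avg
        gcongr with x
        beta_reduce
        rw [← ENNReal.ofReal_mul (Real.rpow_nonneg hl.1.le _)]
        apply ENNReal.ofReal_le_ofReal
        have hnn := Real.rpow_nonneg (hσ x) (1 / r)
        have h1 := rpow_le_loglogBump hr hδ (div_nonneg hnn hl.1.le)
        rw [Real.div_rpow hnn hl.1.le, ← Real.rpow_mul (hσ x), one_div,
          inv_mul_cancel₀ hr0.ne', Real.rpow_one,
          div_le_iff₀' (Real.rpow_pos_of_pos hl.1 _)] at h1
        rwa [abs_of_nonneg hnn, one_div]
    _ = ENNReal.ofReal (l ^ r) *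
          Q.avg fun x => ENNReal.ofReal (loglogBump r δ (|σ x ^ (1 / r)| / l)) := by
        unfold Cube.avg
        rw [lintegral_const_mul' _ _ ENNReal.ofReal_ne_top, mul_left_comm]
    _ ≤ ENNReal.ofReal (l ^ r) := mul_le_of_le_one_right' hl.2

/-! ### Reduction to the diagonal, and the local characteristic. -/

/-- In the chain inequality fix the outer cube `P`. By `hB` the term of an inner cube `Q` is at most
`B * c P ^ q * w P` times `|Q|` with its weight `(3/2)^k`, and these weighted volumes sum to at most
`4 * |P|`. -/
theorem IsLocalFamily.lintegral_tsum_rpow_le {D F : Set (Cube n)} {R : Cube n}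
    (hF : IsLocalFamily D F R) (hS : IsSparse F) (ν : Measure (Fin n → ℝ)) (c w : Cube n → ℝ≥0∞)
    (hν : ∀ Q ∈ F, ν Q.toSet = Q.vol * w Q) {s q : ℝ} (hs : 0 ≤ s) (hsq : s ≤ q) (hq : 0 < q)
    {B : ℝ≥0∞} (hB : ∀ Q ∈ F, ∀ P ∈ F, Q.toSet ⊆ P.toSet → c Q ^ s * w Q ≤ B * (c P ^ s * w P)) :
    ∫⁻ x, (∑' Q : F, (Q : Cube n).toSet.indicator (fun _ => c Q) x) ^ q ∂ν ≤
      chainConst q * (4 * B * ∑' Q : F, c Q ^ q * ν (Q : Cube n).toSet) := by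
  classical
  have : Countable F := hF.countable.to_subtype
  refine (lintegral_tsum_indicator_rpow_le ν (E := fun Q : F => (Q : Cube n).toSet)
    (fun Q => Cube.measurableSet_toSet _) (g := fun Q : F => generation F Q)
    (fun x Q hQ P hP h => Subtype.ext (hF.eq_of_generation_eq Q.2 P.2 hQ hP h))
    (fun Q : F => c Q) hs hsq hq).trans ?_
  gcongr
  rw [← ENNReal.tsum_mul_left]
  refine ENNReal.tsum_le_tsum fun P => ?_
  calc _ ≤ ∑' Q : F, (if (Q : Cube n).toSet ⊆ (P : Cube n).toSet ∧
          generation F P ≤ generation F Q then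
          (3 / 2 : ℝ≥0∞) ^ (generation F Q - generation F P) * (Q : Cube n).vol else 0) *
          (B * (c P ^ q * w P)) := by
        refine ENNReal.tsum_le_tsum fun Q => ?_
        by_cases hg : generation F P ≤ generation F Q
        · rw [if_pos hg]
          rcases ((Q : Cube n).toSet ∩ (P : Cube n).toSet).eq_empty_or_nonempty with h0 | ⟨x, hx⟩
          · rw [h0]; simp
          · have hsub := hF.subset_of_generation_le Q.2 P.2 hx.1 hx.2 hg
            rw [if_pos ⟨hsub, hg⟩, Set.inter_eq_left.2 hsub, hν Q Q.2]
            calc (3 / 2 : ℝ≥0∞) ^ (generation F Q - generation F P) *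
                  (c Q ^ s * c P ^ (q - s)) * ((Q : Cube n).vol * w Q)
                = (3 / 2 : ℝ≥0∞) ^ (generation F Q - generation F P) * (Q : Cube n).vol *
                  (c Q ^ s * w Q * c P ^ (q - s)) := by ring
              _ ≤ (3 / 2 : ℝ≥0∞) ^ (generation F Q - generation F P) * (Q : Cube n).vol *
                  (B * (c P ^ s * w P) * c P ^ (q - s)) := by
                exact mul_le_mul' le_rfl (mul_le_mul' (hB Q Q.2 P P.2 hsub) le_rfl)
              _ = _ := by
                have : c P ^ q = c P ^ s * c P ^ (q - s) := by
                  rw [← ENNReal.rpow_add_of_nonneg _ _ hs (sub_nonneg.2 hsq)]; congr 1; ring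
                rw [this]; ring
        · rw [if_neg hg]; exact zero_le
    _ ≤ 4 * (P : Cube n).vol * (B * (c P ^ q * w P)) := by
        rw [ENNReal.tsum_mul_right]
        gcongr
        exact hF.tsum_weighted_vol_descendants_le hS P.2
    _ = 4 * B * (c P ^ q * ν (P : Cube n).toSet) := by rw [hν P P.2]; ring

theorem rpow_eq_rpow_sub_one_mul (x : ℝ≥0∞) {r : ℝ} (hr : 1 ≤ r) :
    x ^ r = x ^ (r - 1) * x := by
  conv_rhs => rw [← ENNReal.rpow_one x, ← ENNReal.rpow_mul,
    ← ENNReal.rpow_add_of_nonneg _ _ (by linarith) (by norm_num)]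
  congr 1; ring

/-- In exponential form, identities between products of real powers become linear identities between
exponents. -/
theorem exists_eq_ofReal_exp {x : ℝ≥0∞} (h0 : x ≠ 0) (htop : x ≠ ∞) :
    ∃ t : ℝ, x = ENNReal.ofReal (Real.exp t) :=
  ⟨Real.log x.toReal, by
    rw [Real.exp_log (ENNReal.toReal_pos h0 htop), ENNReal.ofReal_toReal htop]⟩

theorem ofReal_exp_rpow (t r : ℝ) :
    ENNReal.ofReal (Real.exp t) ^ r = ENNReal.ofReal (Real.exp (t * r)) := by
  rw [ENNReal.ofReal_rpow_of_pos (Real.exp_pos t), Real.exp_mul]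

theorem ofReal_exp_mul (t r : ℝ) :
    ENNReal.ofReal (Real.exp t) * ENNReal.ofReal (Real.exp r) =
      ENNReal.ofReal (Real.exp (t + r)) := by
  rw [← ENNReal.ofReal_mul (Real.exp_pos t).le, Real.exp_add]

/-- The local two weight characteristic of `Q` without bumps,
`|Q|^{β + 1/q - 1/p} (⨍_Q u)^{1/q} (⨍_Q σ)^{1/p'}`. -/
noncomputable def localChar (β p q p' : ℝ) (u σ : (Fin n → ℝ) → ℝ≥0∞) (Q : Cube n) : ℝ≥0∞ :=
  Q.vol ^ (β + 1 / q - 1 / p) * (Q.avg u ^ (1 / q) * Q.avg σ ^ (1 / p'))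

variable {β p q p' : ℝ} {u σ : (Fin n → ℝ) → ℝ≥0∞} {Q : Cube n}

/-- The exponent `q / p'` is the one for which both averages are absorbed by the characteristic.
What remains is a power of `|Q|`, nonnegative precisely when `1 ≤ q / p * (1 - β)`, hence increasing
in `Q`. -/
theorem fractional_avg_rpow_mul_avg (hp : p.HolderConjugate p') (hq : 0 < q)
    (hu0 : Q.avg u ≠ 0) (hu : Q.avg u ≠ ∞) (hσ0 : Q.avg σ ≠ 0) (hσ : Q.avg σ ≠ ∞) :
    (Q.vol ^ β * Q.avg σ) ^ (q / p') * Q.avg u =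
      localChar β p q p' u σ Q ^ q * Q.vol ^ (q / p * (1 - β) - 1) := by
  obtain ⟨x, hx⟩ := exists_eq_ofReal_exp hu0 hu
  obtain ⟨y, hy⟩ := exists_eq_ofReal_exp hσ0 hσ
  obtain ⟨v, hv⟩ := exists_eq_ofReal_exp Q.vol_ne_zero Q.vol_ne_top
  rw [localChar, hx, hy, hv]
  simp only [ofReal_exp_rpow, ofReal_exp_mul]
  congr 2
  have h1 : q / p' = q * (1 - 1 / p) := by
    have := hp.inv_add_inv_eq_one
    rw [div_eq_mul_inv, show p'⁻¹ = 1 - 1 / p by rw [one_div]; linarith]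
  have h2 : 1 / p' = 1 - 1 / p := by
    have := hp.inv_add_inv_eq_one
    rw [one_div, one_div]; linarith
  rw [h1, h2]
  have := hp.pos.ne'
  field_simp
  ring

theorem fractional_avg_rpow_mul_setLIntegral (hp : p.HolderConjugate p') (hq : 0 < q)
    (hu0 : Q.avg u ≠ 0) (hu : Q.avg u ≠ ∞) (hσ0 : Q.avg σ ≠ 0) (hσ : Q.avg σ ≠ ∞) :
    (Q.vol ^ β * Q.avg σ) ^ q * (Q.vol * Q.avg u) =
      localChar β p q p' u σ Q ^ q * (Q.vol * Q.avg σ) ^ (q / p) := by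
  obtain ⟨x, hx⟩ := exists_eq_ofReal_exp hu0 hu
  obtain ⟨y, hy⟩ := exists_eq_ofReal_exp hσ0 hσ
  obtain ⟨v, hv⟩ := exists_eq_ofReal_exp Q.vol_ne_zero Q.vol_ne_top
  rw [localChar, hx, hy, hv]
  simp only [ofReal_exp_rpow, ofReal_exp_mul]
  congr 2
  have h2 : 1 / p' = 1 - 1 / p := by
    have := hp.inv_add_inv_eq_one
    rw [one_div, one_div]; linarith
  rw [h2]
  have := hp.pos.ne'
  field_simp
  ring

theorem localChar_ne_zero (hq : 0 < q) (hp' : 0 < p') (h : localChar β p q p' u σ Q ≠ 0) :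
    Q.avg u ≠ 0 ∧ Q.avg σ ≠ 0 := by
  constructor
  · intro h0
    exact h (by rw [localChar, h0, ENNReal.zero_rpow_of_pos (by positivity)]; simp)
  · intro h0
    exact h (by rw [localChar, h0, ENNReal.zero_rpow_of_pos (by positivity)]; simp)

theorem localChar_eq_zero (hq : 0 < q) (hp' : 0 < p') (h : localChar β p q p' u σ Q = 0) :
    Q.avg u = 0 ∨ Q.avg σ = 0 := by
  have hv : Q.vol ^ (β + 1 / q - 1 / p) ≠ 0 :=
    (ENNReal.rpow_pos (pos_iff_ne_zero.2 Q.vol_ne_zero) Q.vol_ne_top).ne'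
  rcases mul_eq_zero.1 ((mul_eq_zero.1 h).resolve_left hv) with h1 | h1
  · exact Or.inl ((ENNReal.rpow_eq_zero_iff_of_pos (by positivity)).1 h1)
  · exact Or.inr ((ENNReal.rpow_eq_zero_iff_of_pos (by positivity)).1 h1)

theorem IsWeight.setLIntegral_ne_top {w : (Fin n → ℝ) → ℝ} (hw : IsWeight w) (Q : Cube n) :
    ∫⁻ x in Q.toSet, ENNReal.ofReal (w x) ≠ ∞ := by
  have h1 : IntegrableOn w (Set.Icc Q.corner fun i => Q.corner i + Q.side) volume :=
    hw.2.integrableOn_isCompact isCompact_Icc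
  have h2 : Q.toSet ⊆ Set.Icc Q.corner fun i => Q.corner i + Q.side :=
    fun x hx => ⟨fun i => (hx i).1, fun i => (hx i).2.le⟩
  exact ((lintegral_ofReal_le_lintegral_enorm _).trans_lt (h1.mono_set h2).2).ne

theorem IsWeight.aemeasurable {w : (Fin n → ℝ) → ℝ} (hw : IsWeight w) :
    AEMeasurable (fun x => ENNReal.ofReal (w x)) volume :=
  hw.2.aestronglyMeasurable.aemeasurable.ennreal_ofReal

/-! ### Estimates on one slice. -/

/-- Slices of a sparse local family on which the two weight characteristic is comparable to
`2 ^ (-a) K`, and the bump of `σ` to at most `2 ^ (a + 1)` times its average. -/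
structure IsSlice (β p q p' δ : ℝ) (u σ : (Fin n → ℝ) → ℝ) (K : ℝ≥0∞) (a : ℕ)
    (F : Set (Cube n)) : Prop where
  lt_char : ∀ Q ∈ F, 2⁻¹ ^ (a + 1) * K < localChar β p q p' (fun x => ENNReal.ofReal (u x))
    (fun x => ENNReal.ofReal (σ x)) Q
  char_le : ∀ Q ∈ F, localChar β p q p' (fun x => ENNReal.ofReal (u x))
    (fun x => ENNReal.ofReal (σ x)) Q ≤ 2⁻¹ ^ a * K
  luxemburg_lt : ∀ Q ∈ F, luxemburgNorm (loglogBump p' δ) (fun x => σ x ^ (1 / p')) Q <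
    ENNReal.ofReal (2 ^ (a + 1)) * (Q.avg fun x => ENNReal.ofReal (σ x)) ^ (1 / p')

/-- The constant in the packing estimate for the slices. -/
noncomputable def packingConst (p p' : ℝ) : ℝ≥0∞ :=
  16 * ENNReal.ofReal (4 * p' * 4 ^ (p - 1) * 2 ^ p + 5)

theorem IsSlice.tsum_weight_le {δ : ℝ} {u σ : (Fin n → ℝ) → ℝ} {K : ℝ≥0∞} {a : ℕ}
    {D F : Set (Cube n)} {R : Cube n} (h : IsSlice β p q p' δ u σ K a F)
    (hF : IsLocalFamily D F R) (hS : IsSparse F) (hp : p.HolderConjugate p') (hq : 0 < q)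
    (hδ : 0 ≤ δ) (hσ : IsWeight σ) :
    ∑' Q : F, ∫⁻ x in (Q : Cube n).toSet, ENNReal.ofReal (σ x) ≤
      packingConst p p' * (2 ^ p) ^ a * ∫⁻ x in R.toSet, ENNReal.ofReal (σ x) := by
  have hp'0 : 0 < p' := hp.symm.pos
  have hae := hσ.aemeasurable.ae_eq_mk
  -- The level bands need a measurable function, while a weight is only almost everywhere
  -- measurable.
  set f := hσ.aemeasurable.mk with hf
  have hfm : Measurable f := hσ.aemeasurable.measurable_mk
  have hint : ∀ Q : Cube n, ∫⁻ x in Q.toSet, ENNReal.ofReal (σ x) = ∫⁻ x in Q.toSet, f x :=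
    fun Q => lintegral_congr_ae (ae_restrict_of_ae hae)
  have havg : ∀ Q : Cube n, (Q.avg fun x => ENNReal.ofReal (σ x)) = Q.avg f :=
    fun Q => Q.avg_congr_ae hae
  have hfin : ∀ Q : Cube n, ∫⁻ x in Q.toSet, f x ≠ ∞ := fun Q =>
    hint Q ▸ hσ.setLIntegral_ne_top Q
  have h0 : ∀ Q ∈ F, Q.avg f ≠ 0 := fun Q hQ =>
    havg Q ▸ (localChar_ne_zero hq hp'0 (zero_le.trans_lt (h.lt_char Q hQ)).ne').2
  -- The threshold of `setLIntegral_high_le` for `L = 2 ^ (a + 1)`; this is the source of the growth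
  -- `(2 ^ p) ^ a`.
  set X : ℝ := 4 * p' * 4 ^ (p - 1) * (2 ^ (a + 1)) ^ p with hX
  have hmain := hF.tsum_setLIntegral_le hS hfm (hfin R) h0 ⌈X⌉₊ (fun Q hQ =>
    setLIntegral_high_le hp hδ (L := 2 ^ (a + 1)) (one_le_pow₀ (by norm_num)) (Nat.le_ceil X)
      hσ.1 hfm hae.symm (h0 Q hQ) (Cube.avg_ne_top (hfin Q)) (havg Q ▸ h.luxemburg_lt Q hQ))
  simp_rw [hint]
  refine hmain.trans ?_
  have hX' : X = 4 * p' * 4 ^ (p - 1) * 2 ^ p * (2 ^ p) ^ a := by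
    rw [hX, ← Real.rpow_natCast, ← Real.rpow_mul (by norm_num), mul_comm ((a + 1 : ℕ) : ℝ) p,
      Real.rpow_mul (by norm_num), Real.rpow_natCast, pow_succ']
    ring
  have h1 : (1 : ℝ) ≤ (2 ^ p) ^ a := one_le_pow₀ (Real.one_le_rpow (by norm_num) hp.pos.le)
  have hX0 : 0 ≤ X := by positivity
  have hceil : (⌈X⌉₊ : ℝ) + 4 ≤ (4 * p' * 4 ^ (p - 1) * 2 ^ p + 5) * (2 ^ p) ^ a := by
    have := (Nat.ceil_lt_add_one hX0).le
    rw [add_mul, ← hX']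
    linarith
  have hle : (⌈X⌉₊ : ℝ≥0∞) + 4 ≤
      ENNReal.ofReal (4 * p' * 4 ^ (p - 1) * 2 ^ p + 5) * (2 ^ p) ^ a := by
    calc (⌈X⌉₊ : ℝ≥0∞) + 4 = ENNReal.ofReal ((⌈X⌉₊ : ℝ) + 4) := by
          rw [ENNReal.ofReal_add (by positivity) (by norm_num)]; simp
      _ ≤ ENNReal.ofReal ((4 * p' * 4 ^ (p - 1) * 2 ^ p + 5) * (2 ^ p) ^ a) :=
          ENNReal.ofReal_le_ofReal hceil
      _ = _ := by
          rw [ENNReal.ofReal_mul (by positivity), ENNReal.ofReal_pow (by positivity),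
            ← ENNReal.ofReal_rpow_of_pos (by norm_num)]
          simp
  calc 16 * (((⌈X⌉₊ : ℝ≥0∞) + 4) * ∫⁻ x in R.toSet, f x)
      ≤ 16 * (ENNReal.ofReal (4 * p' * 4 ^ (p - 1) * 2 ^ p + 5) * (2 ^ p) ^ a *
        ∫⁻ x in R.toSet, f x) := by gcongr
    _ = _ := by rw [packingConst]; ring

/-- The constant in the estimate for the slices. -/
noncomputable def sliceConst (p q p' : ℝ) : ℝ≥0∞ :=
  chainConst q * (4 * 2 ^ q * packingConst p p')

theorem sliceConst_ne_top (hq : 0 < q) : sliceConst p q p' ≠ ∞ :=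
  ENNReal.mul_ne_top (chainConst_ne_top hq) (ENNReal.mul_ne_top (ENNReal.mul_ne_top (by norm_num)
    (ENNReal.rpow_ne_top_of_nonneg hq.le (by norm_num)))
    (ENNReal.mul_ne_top (by norm_num) ENNReal.ofReal_ne_top))

theorem IsSlice.lintegral_rpow_le {δ : ℝ} {u σ : (Fin n → ℝ) → ℝ} {K : ℝ≥0∞} {a : ℕ}
    {D F : Set (Cube n)} {R : Cube n} (h : IsSlice β p q p' δ u σ K a F)
    (hF : IsLocalFamily D F R) (hS : IsSparse F) (hp : p.HolderConjugate p') (hpq : p < q)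
    (hβ : 1 ≤ q / p * (1 - β)) (hδ : 0 ≤ δ) (hu : IsWeight u) (hσ : IsWeight σ) :
    ∫⁻ x, (∑' Q : F, (Q : Cube n).toSet.indicator (fun _ => (Q : Cube n).vol ^ β *
        (Q : Cube n).avg fun y => ENNReal.ofReal (σ y)) x) ^ q
        ∂(volume.withDensity fun x => ENNReal.ofReal (u x)) ≤
      sliceConst p q p' * (2 ^ p * 2⁻¹ ^ q) ^ a * K ^ q *
        (∫⁻ x in R.toSet, ENNReal.ofReal (σ x)) ^ (q / p) := by
  have hp0 : 0 < p := hp.pos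
  have hq0 : 0 < q := hp0.trans hpq
  have hp'0 : 0 < p' := hp.symm.pos
  have hp'1 : 1 < p' := hp.symm.lt
  have hqp : 1 ≤ q / p := (one_le_div hp0).2 hpq.le
  have hqp' : 0 ≤ q / p - 1 := sub_nonneg.2 hqp
  set uu : (Fin n → ℝ) → ℝ≥0∞ := fun x => ENNReal.ofReal (u x)
  set ss : (Fin n → ℝ) → ℝ≥0∞ := fun x => ENNReal.ofReal (σ x)
  set ν := volume.withDensity uu with hν
  have hνQ : ∀ Q : Cube n, ν Q.toSet = Q.vol * Q.avg uu := fun Q => by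
    rw [hν, withDensity_apply _ Q.measurableSet_toSet, Q.vol_mul_avg]
  have h0 : ∀ Q ∈ F, Q.avg uu ≠ 0 ∧ Q.avg ss ≠ 0 := fun Q hQ =>
    localChar_ne_zero hq0 hp'0 (zero_le.trans_lt (h.lt_char Q hQ)).ne'
  have hut : ∀ Q : Cube n, Q.avg uu ≠ ∞ := fun Q => Cube.avg_ne_top (hu.setLIntegral_ne_top Q)
  have hst : ∀ Q : Cube n, Q.avg ss ≠ ∞ := fun Q => Cube.avg_ne_top (hσ.setLIntegral_ne_top Q)
  have hratio : ∀ Q ∈ F, ∀ P ∈ F, Q.toSet ⊆ P.toSet →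
      (Q.vol ^ β * Q.avg ss) ^ (q / p') * Q.avg uu ≤
        2 ^ q * ((P.vol ^ β * P.avg ss) ^ (q / p') * P.avg uu) := by
    intro Q hQ P hP hQP
    rw [fractional_avg_rpow_mul_avg hp hq0 (h0 Q hQ).1 (hut Q) (h0 Q hQ).2 (hst Q),
      fractional_avg_rpow_mul_avg hp hq0 (h0 P hP).1 (hut P) (h0 P hP).2 (hst P), ← mul_assoc,
      ← ENNReal.mul_rpow_of_nonneg _ _ hq0.le]
    have h1 : localChar β p q p' uu ss Q ≤ 2 * localChar β p q p' uu ss P := by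
      refine (h.char_le Q hQ).trans ?_
      calc 2⁻¹ ^ a * K = 2 * (2⁻¹ ^ (a + 1) * K) := by
            rw [pow_succ', ← mul_assoc, ← mul_assoc, ENNReal.mul_inv_cancel (by simp) (by simp),
              one_mul]
        _ ≤ _ := by gcongr; exact (h.lt_char P hP).le
    have h2 : Q.vol ≤ P.vol := measure_mono hQP
    have h3 : 0 ≤ q / p * (1 - β) - 1 := by linarith
    gcongr
  -- Since `q / p ≥ 1`, one factor `σ(Q)` is kept for the packing estimate and the remaining power
  -- is enlarged to that of `σ(R)`.
  have hsum : ∑' Q : F, ((Q : Cube n).vol ^ β * (Q : Cube n).avg ss) ^ q * ν (Q : Cube n).toSet ≤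
      (2⁻¹ ^ a * K) ^ q * ((∫⁻ x in R.toSet, ss x) ^ (q / p - 1) *
        ∑' Q : F, ∫⁻ x in (Q : Cube n).toSet, ss x) := by
    rw [← ENNReal.tsum_mul_left, ← ENNReal.tsum_mul_left]
    refine ENNReal.tsum_le_tsum fun Q => ?_
    rw [hνQ, fractional_avg_rpow_mul_setLIntegral hp hq0 (h0 Q Q.2).1 (hut Q) (h0 Q Q.2).2 (hst Q),
      Cube.vol_mul_avg]
    rw [rpow_eq_rpow_sub_one_mul _ hqp]
    gcongr
    · exact h.char_le Q Q.2
    · exact hF.subset Q Q.2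
  refine (hF.lintegral_tsum_rpow_le hS ν (fun Q => Q.vol ^ β * Q.avg ss) (fun Q => Q.avg uu)
    (fun Q _ => hνQ Q) (s := q / p') (by positivity) (div_le_self hq0.le hp'1.le) hq0
    hratio).trans ?_
  have hpow : ((2⁻¹ : ℝ≥0∞) ^ a * K) ^ q = (2⁻¹ ^ q) ^ a * K ^ q := by
    rw [ENNReal.mul_rpow_of_nonneg _ _ hq0.le, ← ENNReal.rpow_natCast, ← ENNReal.rpow_mul,
      mul_comm (a : ℝ), ENNReal.rpow_mul, ENNReal.rpow_natCast]
  calc _ ≤ chainConst q * (4 * 2 ^ q * ((2⁻¹ ^ a * K) ^ q *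
        ((∫⁻ x in R.toSet, ss x) ^ (q / p - 1) *
          (packingConst p p' * (2 ^ p) ^ a * ∫⁻ x in R.toSet, ss x)))) := by
        gcongr
        refine hsum.trans ?_
        gcongr
        exact h.tsum_weight_le hF hS hp hq0 hδ hσ
    _ = _ := by
        rw [hpow, rpow_eq_rpow_sub_one_mul _ hqp, sliceConst, mul_pow]
        ring

/-! ### Summation over the slices. -/

/-- The constant in the testing inequality, raised to the power `q`. -/
noncomputable def testingBound (p q p' : ℝ) : ℝ≥0∞ :=
  (∑' a : ℕ, (((2 : ℝ≥0∞) ^ ((q - p) / 2))⁻¹ ^ (1 / q)) ^ a) ^ q *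
    (sliceConst p q p' * ∑' a : ℕ, ((2 : ℝ≥0∞) ^ ((p - q) / 2)) ^ a)

theorem tsum_pow_ne_top {r : ℝ≥0∞} (hr : r < 1) : ∑' a : ℕ, r ^ a ≠ ∞ := by
  rw [ENNReal.tsum_geometric]
  exact ENNReal.inv_ne_top.2 (tsub_pos_of_lt hr).ne'

theorem testingBound_ne_top {p q p' : ℝ} (hq : 0 < q) (hpq : p < q) :
    testingBound p q p' ≠ ∞ := by
  refine ENNReal.mul_ne_top (ENNReal.rpow_ne_top_of_nonneg hq.le (tsum_pow_ne_top ?_))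
    (ENNReal.mul_ne_top (sliceConst_ne_top hq) (tsum_pow_ne_top ?_))
  · refine ENNReal.rpow_lt_one (ENNReal.inv_lt_one.2 ?_) (by positivity)
    exact ENNReal.one_lt_rpow (by norm_num) (by linarith)
  · exact ENNReal.rpow_lt_one_of_one_lt_of_neg (by norm_num) (by linarith)

theorem exists_slice_index {A K : ℝ≥0∞} (hA0 : A ≠ 0) (hAK : A ≤ K) (hK : K ≠ ∞) :
    ∃ a : ℕ, 2⁻¹ ^ (a + 1) * K < A ∧ A ≤ 2⁻¹ ^ a * K := by
  classical
  have hex : ∃ a : ℕ, 2⁻¹ ^ (a + 1) * K < A := by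
    have h1 : Filter.Tendsto (fun a : ℕ => (2⁻¹ : ℝ≥0∞) ^ (a + 1) * K) Filter.atTop (nhds 0) := by
      have h2 := (ENNReal.tendsto_pow_atTop_nhds_zero_of_lt_one (r := 2⁻¹)
        (ENNReal.inv_lt_one.2 (by norm_num))).comp (Filter.tendsto_add_atTop_nat 1)
      simpa using ENNReal.Tendsto.mul_const h2 (Or.inr hK)
    exact (h1.eventually (gt_mem_nhds (pos_iff_ne_zero.2 hA0))).exists
  refine ⟨Nat.find hex, Nat.find_spec hex, ?_⟩
  rcases Nat.eq_zero_or_pos (Nat.find hex) with h0 | h0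
  · rw [h0]; simpa using hAK
  · have := Nat.find_min hex (Nat.sub_lt h0 one_pos)
    rw [Nat.sub_add_cancel (Nat.one_le_of_lt h0)] at this
    exact not_lt.1 this

theorem powerNorm_rpow_one_div {q : ℝ} (hq : 0 < q) {u : (Fin n → ℝ) → ℝ} (hu : ∀ x, 0 ≤ u x)
    (Q : Cube n) : powerNorm q (fun x => u x ^ (1 / q)) Q =
      (Q.avg fun x => ENNReal.ofReal (u x)) ^ (1 / q) := by
  unfold powerNorm
  congr 2
  ext x
  rw [abs_of_nonneg (Real.rpow_nonneg (hu x) _), ← Real.rpow_mul (hu x), one_div,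
    inv_mul_cancel₀ hq.ne', Real.rpow_one]

theorem two_rpow_slice (p q : ℝ) :
    (2 : ℝ≥0∞) ^ ((q - p) / 2) * (2 ^ p * 2⁻¹ ^ q) = 2 ^ ((p - q) / 2) := by
  rw [ENNReal.inv_rpow, ← ENNReal.rpow_neg, ← ENNReal.rpow_add _ _ (by norm_num) (by norm_num),
    ← ENNReal.rpow_add _ _ (by norm_num) (by norm_num)]
  congr 1; ring

theorem IsLocalFamily.lintegral_tsum_weight_le {β p q p' δ : ℝ} {u σ : (Fin n → ℝ) → ℝ}
    {K : ℝ≥0∞} {D F : Set (Cube n)} {R : Cube n}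
    (hF : IsLocalFamily D F R) (hS : IsSparse F) (hp : p.HolderConjugate p') (hpq : p < q)
    (hβ : 1 ≤ q / p * (1 - β)) (hδ : 0 ≤ δ) (hu : IsWeight u) (hσ : IsWeight σ) (hK : K ≠ ∞)
    (hbump : ∀ Q : Cube n, Q.vol ^ (β + 1 / q - 1 / p) *
      ((Q.avg fun x => ENNReal.ofReal (u x)) ^ (1 / q) *
        luxemburgNorm (loglogBump p' δ) (fun x => σ x ^ (1 / p')) Q) ≤ K) :
    ∫⁻ x, (∑' Q : F, (Q : Cube n).toSet.indicator (fun _ => (Q : Cube n).vol ^ β *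
        (Q : Cube n).avg fun y => ENNReal.ofReal (σ y)) x) ^ q
        ∂(volume.withDensity fun x => ENNReal.ofReal (u x)) ≤
      testingBound p q p' * K ^ q *
        (∫⁻ x in R.toSet, ENNReal.ofReal (σ x)) ^ (q / p) := by
  have hp0 : 0 < p := hp.pos
  have hq0 : 0 < q := hp0.trans hpq
  have hp'0 : 0 < p' := hp.symm.pos
  have hcount : Countable F := hF.countable.to_subtype
  set A : Cube n → ℝ≥0∞ := localChar β p q p' (fun x => ENNReal.ofReal (u x))
    (fun x => ENNReal.ofReal (σ x)) with hA
  set G : ℕ → Set (Cube n) := fun a => {Q | Q ∈ F ∧ 2⁻¹ ^ (a + 1) * K < A Q ∧ A Q ≤ 2⁻¹ ^ a * K}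
    with hG
  have hGF : ∀ a, G a ⊆ F := fun a Q hQ => hQ.1
  have hslice : ∀ a, IsSlice β p q p' δ u σ K a (G a) := by
    intro a
    refine ⟨fun Q hQ => hQ.2.1, fun Q hQ => hQ.2.2, fun Q hQ => ?_⟩
    -- Otherwise the bumped characteristic would be at least `2 ^ (a + 1) * A Q`, which exceeds `K`
    -- on this slice.
    by_contra hlt
    refine absurd (hbump Q) (not_le.2 ?_)
    have h1 : K < 2 ^ (a + 1) * A Q := by
      have h2 := ENNReal.mul_lt_mul_right (a := 2 ^ (a + 1)) (by simp) (by simp) hQ.2.1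
      rwa [← mul_assoc, ← mul_pow, ENNReal.mul_inv_cancel (by simp) (by simp), one_pow,
        one_mul] at h2
    refine h1.trans_le ?_
    rw [ENNReal.ofReal_pow (by norm_num), show ENNReal.ofReal 2 = 2 by simp] at hlt
    calc 2 ^ (a + 1) * A Q = Q.vol ^ (β + 1 / q - 1 / p) *
          ((Q.avg fun x => ENNReal.ofReal (u x)) ^ (1 / q) *
            (2 ^ (a + 1) * (Q.avg fun x => ENNReal.ofReal (σ x)) ^ (1 / p'))) := by
          rw [hA, localChar]; ring
      _ ≤ _ := by gcongr; exact not_lt.1 hlt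
  have hAK : ∀ Q, A Q ≤ K := by
    intro Q
    refine le_trans ?_ (hbump Q)
    rw [hA, localChar]
    gcongr
    exact avg_rpow_le_luxemburgNorm hp.symm.lt hδ hσ.1 Q
  set c : Cube n → ℝ≥0∞ := fun Q => Q.vol ^ β * Q.avg fun y => ENNReal.ofReal (σ y) with hc
  set ν := volume.withDensity fun x => ENNReal.ofReal (u x) with hν
  set T : ℕ → (Fin n → ℝ) → ℝ≥0∞ := fun a x =>
    ∑' Q : G a, (Q : Cube n).toSet.indicator (fun _ => c Q) x with hT
  have hTm : ∀ a, Measurable (T a) := by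
    intro a
    have : Countable (G a) := (hF.mono (hGF a)).countable.to_subtype
    exact Measurable.tsum fun Q : G a => measurable_const.indicator (Cube.measurableSet_toSet _)
  -- Cubes with `A Q = 0` lie in no slice but do not matter: either `u` has no mass on `Q`, or the
  -- coefficient `c Q` vanishes.
  have hnull : ∀ᵐ x ∂ν, ∀ Q : F, A Q = 0 → (Q : Cube n).toSet.indicator (fun _ => c Q) x = 0 := by
    rw [ae_all_iff]
    intro Q
    by_cases hAQ : A Q = 0
    · rcases localChar_eq_zero hq0 hp'0 hAQ with h0 | h0
      · have hν0 : ν (Q : Cube n).toSet = 0 := by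
          rw [hν, withDensity_apply _ (Cube.measurableSet_toSet _), ← Cube.vol_mul_avg, h0,
            mul_zero]
        filter_upwards [measure_eq_zero_iff_ae_notMem.1 hν0] with x hx _
        exact Set.indicator_of_notMem hx _
      · refine Filter.Eventually.of_forall fun x _ => ?_
        simp [hc, h0]
    · exact Filter.Eventually.of_forall fun x h => absurd h hAQ
  have hle : ∀ᵐ x ∂ν, ∑' Q : F, (Q : Cube n).toSet.indicator (fun _ => c Q) x ≤ ∑' a, T a x := by
    filter_upwards [hnull] with x hx
    refine le_trans ?_ (ENNReal.tsum_iUnion_le_tsum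
      (fun Q : Cube n => Q.toSet.indicator (fun _ => c Q) x) G)
    rw [tsum_subtype F (fun Q : Cube n => Q.toSet.indicator (fun _ => c Q) x),
      tsum_subtype (⋃ a, G a) (fun Q : Cube n => Q.toSet.indicator (fun _ => c Q) x)]
    refine ENNReal.tsum_le_tsum fun Q => ?_
    by_cases hQ : Q ∈ F
    · by_cases hAQ : A Q = 0
      · rw [Set.indicator_of_mem hQ, hx ⟨Q, hQ⟩ hAQ]
        exact zero_le
      · obtain ⟨a, ha1, ha2⟩ := exists_slice_index hAQ (hAK Q) hK
        have hQG : Q ∈ ⋃ a, G a := Set.mem_iUnion.2 ⟨a, hQ, ha1, ha2⟩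
        rw [Set.indicator_of_mem hQ, Set.indicator_of_mem hQG]
    · rw [Set.indicator_of_notMem hQ]
      exact zero_le
  -- Half of the available decay `2 ^ (p - q)` pays for separating the slices; the other half leaves
  -- a convergent geometric series.
  set r : ℝ≥0∞ := 2 ^ ((q - p) / 2) with hr
  set S := ∫⁻ x in R.toSet, ENNReal.ofReal (σ x)
  have hr0 : r ≠ 0 := (ENNReal.rpow_pos (by norm_num) (by norm_num)).ne'
  have hrt : r ≠ ∞ := ENNReal.rpow_ne_top_of_nonneg (by linarith) (by norm_num)
  calc _ ≤ ∫⁻ x, (∑' a, T a x) ^ q ∂ν := by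
        refine lintegral_mono_ae ?_
        filter_upwards [hle] with x hx
        gcongr
    _ ≤ ∫⁻ x, (∑' a : ℕ, (r⁻¹ ^ (1 / q)) ^ a) ^ q * ∑' a, r ^ a * T a x ^ q ∂ν :=
        lintegral_mono fun x => tsum_rpow_le_tsum_geometric hq0 hr0 hrt fun a => T a x
    _ = (∑' a : ℕ, (r⁻¹ ^ (1 / q)) ^ a) ^ q * ∑' a, r ^ a * ∫⁻ x, T a x ^ q ∂ν := by
        have hm : ∀ a, Measurable fun x => r ^ a * T a x ^ q := fun a =>
          ((hTm a).pow_const q).const_mul _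
        rw [lintegral_const_mul _ (Measurable.tsum hm), lintegral_tsum fun a => (hm a).aemeasurable]
        congr 2
        ext a
        rw [lintegral_const_mul _ ((hTm a).pow_const q)]
    _ ≤ (∑' a : ℕ, (r⁻¹ ^ (1 / q)) ^ a) ^ q * ∑' a : ℕ, r ^ a *
          (sliceConst p q p' * (2 ^ p * 2⁻¹ ^ q) ^ a * K ^ q * S ^ (q / p)) := by
        gcongr with a
        exact (hslice a).lintegral_rpow_le (hF.mono (hGF a)) (hS.mono (hGF a)) hp hpq hβ hδ hu hσ
    _ = (∑' a : ℕ, (r⁻¹ ^ (1 / q)) ^ a) ^ q * ∑' a : ℕ,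
          sliceConst p q p' * K ^ q * S ^ (q / p) * ((2 : ℝ≥0∞) ^ ((p - q) / 2)) ^ a := by
        congr 2
        ext a
        rw [← two_rpow_slice, mul_pow _ _ a]
        ring
    _ = _ := by
        rw [ENNReal.tsum_mul_left, testingBound]
        ring

/-! ### From the family estimate to the testing constants. -/

theorem isLocalFamily_localFamily {D S : Set (Cube n)} (hD : IsDyadicGrid D) (hn : n ≠ 0)
    (hS : S ⊆ D) (R : Cube n) : IsLocalFamily D (localFamily S R) R :=
  ⟨hD, hn, fun _ hQ => hS hQ.1, fun _ hQ => hQ.2⟩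

theorem dyadicRiesz_localFamily_indicator (α : ℝ) (S : Set (Cube n)) (R : Cube n)
    (f : (Fin n → ℝ) → ℝ≥0∞) (x : Fin n → ℝ) :
    dyadicRiesz α (localFamily S R) (R.toSet.indicator f) x =
      ∑' Q : localFamily S R, (Q : Cube n).toSet.indicator
        (fun _ => (Q : Cube n).vol ^ (α / (n : ℝ)) * (Q : Cube n).avg f) x := by
  unfold dyadicRiesz
  refine tsum_congr fun Q => ?_
  have h : (Q : Cube n).avg (R.toSet.indicator f) = (Q : Cube n).avg f := by
    unfold Cube.avg
    rw [setLIntegral_congr_fun (Cube.measurableSet_toSet _)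
      fun y hy => Set.indicator_of_mem (Q.2.2 hy) f]
  rw [h]

theorem testingConst_le {α p q p' δ : ℝ} (hn : n ≠ 0) (hp : p.HolderConjugate p') (hpq : p < q)
    (hα : 1 ≤ q / p * (1 - α / (n : ℝ))) (hδ : 0 ≤ δ) {u σ : (Fin n → ℝ) → ℝ} (hu : IsWeight u)
    (hσ : IsWeight σ) {K : ℝ≥0∞} (hK : K ≠ ∞)
    (hbump : bumpConst α p q (powerNorm q (fun x => u x ^ (1 / q)))
      (luxemburgNorm (loglogBump p' δ) (fun x => σ x ^ (1 / p'))) ≤ K)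
    {D S : Set (Cube n)} (hD : IsDyadicGrid D) (hSD : S ⊆ D) (hS : IsSparse S) :
    testingConst α p q D S u σ ≤ testingBound p q p' ^ (1 / q) * K := by
  have hp0 : 0 < p := hp.pos
  have hq0 : 0 < q := hp0.trans hpq
  refine iSup₂_le fun R _ => ?_
  have hF := isLocalFamily_localFamily hD hn hSD R
  have hcount : Countable (localFamily S R) := hF.countable.to_subtype
  have hmain := hF.lintegral_tsum_weight_le (hS.mono fun _ hQ => hQ.1) hp hpq hα hδ hu hσ hK
    (fun Q => by
      rw [← powerNorm_rpow_one_div hq0 hu.1]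
      exact (le_iSup (fun Q : Cube n => Q.vol ^ (α / (n : ℝ) + 1 / q - 1 / p) *
        (powerNorm q (fun x => u x ^ (1 / q)) Q *
          luxemburgNorm (loglogBump p' δ) (fun x => σ x ^ (1 / p')) Q)) Q).trans hbump)
  have hTm : Measurable fun x => (∑' Q : localFamily S R, (Q : Cube n).toSet.indicator
      (fun _ => (Q : Cube n).vol ^ (α / (n : ℝ)) *
        (Q : Cube n).avg fun y => ENNReal.ofReal (σ y)) x) ^ q :=
    (Measurable.tsum fun Q : localFamily S R =>
      measurable_const.indicator (Cube.measurableSet_toSet _)).pow_const q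
  rw [lintegral_withDensity_eq_lintegral_mul₀ hu.aemeasurable hTm.aemeasurable] at hmain
  have hint : ∫⁻ x in R.toSet, dyadicRiesz α (localFamily S R)
        (R.toSet.indicator fun y => ENNReal.ofReal (σ y)) x ^ q * ENNReal.ofReal (u x) ≤
      testingBound p q p' * K ^ q * weightedMeasure σ R.toSet ^ (q / p) := by
    refine (setLIntegral_le_lintegral _ _).trans (le_trans (le_of_eq ?_) hmain)
    refine lintegral_congr fun x => ?_
    rw [dyadicRiesz_localFamily_indicator, Pi.mul_apply, mul_comm]
  set W := weightedMeasure σ R.toSet with hW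
  have hWtop : W ≠ ∞ := hσ.setLIntegral_ne_top R
  calc _ ≤ W ^ (-(1 / p)) * (testingBound p q p' * K ^ q * W ^ (q / p)) ^ (1 / q) := by gcongr
    _ = W ^ (-(1 / p)) * W ^ (1 / p) * (testingBound p q p' ^ (1 / q) * K) := by
        have hq1 : 0 ≤ 1 / q := by positivity
        rw [ENNReal.mul_rpow_of_nonneg _ _ hq1, ENNReal.mul_rpow_of_nonneg _ _ hq1,
          ← ENNReal.rpow_mul, ← ENNReal.rpow_mul, mul_one_div_cancel hq0.ne', ENNReal.rpow_one,
          show q / p * (1 / q) = 1 / p by field_simp]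
        ring
    _ ≤ 1 * (testingBound p q p' ^ (1 / q) * K) := by
        gcongr
        -- For `W = 0` the negative power is `∞` and the positive one is `0`, so the convention `∞ *
        -- 0 = 0` settles the case.
        rcases eq_or_ne W 0 with h0 | h0
        · rw [h0, ENNReal.zero_rpow_of_pos (by positivity : 0 < 1 / p)]
          simp
        · rw [← ENNReal.rpow_add _ _ h0 hWtop, neg_add_cancel, ENNReal.rpow_zero]
    _ = _ := one_mul _

end DyadicRiesz

theorem mainTheorem9 (n : ℕ) (α p q p' q' : ℝ) (hα : 0 < α) (hαn : α < (n : ℝ))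
    (hp : 1 < p) (hpq : p < q) (hp' : p.HolderConjugate p') (hq' : q.HolderConjugate q') :
    (1 ≤ p' / q' * (1 - α / (n : ℝ)) →
      ∃ δ₀ : ℝ, 0 < δ₀ ∧ ∀ δ : ℝ, δ₀ ≤ δ → ∃ C : ℝ≥0,
        ∀ u σ : (Fin n → ℝ) → ℝ, IsWeight u → IsWeight σ →
          ∀ K : ℝ≥0∞,
            K = bumpConst α p q (luxemburgNorm (loglogBump q δ) (fun x => u x ^ (1 / q)))
              (powerNorm p' (fun x => σ x ^ (1 / p'))) →
            K < ∞ →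
            ∀ D S : Set (Cube n), IsDyadicGrid D → S ⊆ D → IsSparse S →
              testingConst α q' p' D S σ u ≤ (C : ℝ≥0∞) * K) ∧
    (1 ≤ q / p * (1 - α / (n : ℝ)) →
      ∃ δ₀ : ℝ, 0 < δ₀ ∧ ∀ δ : ℝ, δ₀ ≤ δ → ∃ C : ℝ≥0,
        ∀ u σ : (Fin n → ℝ) → ℝ, IsWeight u → IsWeight σ →
          ∀ K : ℝ≥0∞,
            K = bumpConst α p q (powerNorm q (fun x => u x ^ (1 / q)))
              (luxemburgNorm (loglogBump p' δ) (fun x => σ x ^ (1 / p'))) →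
            K < ∞ →
            ∀ D S : Set (Cube n), IsDyadicGrid D → S ⊆ D → IsSparse S →
              testingConst α p q D S u σ ≤ (C : ℝ≥0∞) * K) := by

  have hn : n ≠ 0 := by
    rintro rfl
    simp only [Nat.cast_zero] at hαn
    linarith
  have hq'p' : q' < p' := by
    have h1 := hp'.inv_add_inv_eq_one
    have h2 := hq'.inv_add_inv_eq_one
    have h3 : q⁻¹ < p⁻¹ := inv_strictAnti₀ (by linarith) hpq
    exact (inv_lt_inv₀ hp'.symm.pos hq'.symm.pos).1 (by linarith)
  constructor
  · intro hcond
    -- Any positive threshold would do, since only `0 ≤ δ` is needed and the constant does not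
    -- involve `δ`.
    refine ⟨1, one_pos, fun δ hδ => ⟨(testingBound q' p' q ^ (1 / p')).toNNReal, ?_⟩⟩
    intro u σ hu hσ K hK hKtop D S hD hSD hS
    rw [ENNReal.coe_toNNReal (ENNReal.rpow_ne_top_of_nonneg
      (one_div_nonneg.2 hp'.symm.pos.le) (testingBound_ne_top hp'.symm.pos hq'p'))]
    -- Duality: the exponents `q' < p'` take the place of `p < q`, the weights are exchanged, and
    -- the power of `|Q|` is unchanged because `1/p' - 1/q' = 1/q - 1/p`.
    refine testingConst_le hn hq'.symm hq'p' hcond (by linarith : 0 ≤ δ) hσ hu hKtop.ne ?_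
      hD hSD hS
    rw [hK]
    refine le_of_eq (iSup_congr fun Q => ?_)
    have h1 := hp'.inv_add_inv_eq_one
    have h2 := hq'.inv_add_inv_eq_one
    have h3 : α / (n : ℝ) + 1 / p' - 1 / q' = α / (n : ℝ) + 1 / q - 1 / p := by
      simp only [one_div]
      linarith
    rw [h3, mul_comm (powerNorm _ _ _)]
  · intro hcond
    refine ⟨1, one_pos, fun δ hδ => ⟨(testingBound p q p' ^ (1 / q)).toNNReal, ?_⟩⟩
    intro u σ hu hσ K hK hKtop D S hD hSD hS
    have hq0 : 0 < q := by linarith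
    rw [ENNReal.coe_toNNReal (ENNReal.rpow_ne_top_of_nonneg
      (one_div_nonneg.2 hq0.le) (testingBound_ne_top hq0 hpq))]
    exact testingConst_le hn hp' hpq hcond (by linarith : 0 ≤ δ) hu hσ hKtop.ne hK.ge hD hSD hS
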